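/- Let $\phi:X\to Y$ be a non-singular double cover over $\mathbb C$, i.e. a finite surjective morphism of degree $2$ between smooth (integral, separated, finite type) varieties over $\mathbb C$, let $\iota:X\to X$ be its covering transformation (the non-trivial automorphism of $X$ over $Y$), and let $L$ be a divisor on $Y$ with $\phi_*\mathcal O_X\cong\mathcal O_Y\oplus\mathcal O_Y(-L)$ as $\mathcal O_Y$-modules. Let $B_\phi$ be the branch locus of $\phi$, regarded as a reduced effective divisor on $Y$ (so that $2L\sim B_\phi$), and let $F\in H^0(Y,\mathcal O_Y(2L))$ be a section with zero divisor $B_\phi$. Assume that $H^0(Y,\mathcal O_Y)=\mathbb C$. Let $D^+$ be an effective divisor on $X$, and let $D$ be the effective divisor on $Y$ defined by $f=0$ for some $f\in H^0(Y,\mathcal O_Y(D))$, such that $\phi^*D=D^++\iota^*D^+$. (1) Let $D'$ be a divisor on $Y$ such that either $\mathcal O_Y(D')\cong\mathcal O_Y$ or $H^0(Y,\mathcal O_Y(D'))=0$. If $\phi_*\mathcal O_X(D^+)\cong\mathcal O_Y(D')\oplus\mathcal O_Y$ as $\mathcal O_Y$-modules, then (i) $D'$ is linearly equivalent to $D-L$;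 and (ii) there are $a_0\in H^0(Y,\mathcal O_Y(L))$ and $a_1\in H^0(Y,\mathcal O_Y(2L-D))$ such that $F=a_0^2+f\,a_1$ in $H^0(Y,\mathcal O_Y(2L))$. (2) Conversely, if $D^+$ is irreducible (a prime divisor) and (ii) holds, then $\phi_*\mathcal O_X(D^+)\cong\mathcal O_Y(D-L)\oplus\mathcal O_Y$. -/

import Mathlib

open CategoryTheory CategoryTheory.Limits AlgebraicGeometry TopologicalSpace Opposite

universe u

namespace DoubleCover

noncomputable section

section Divisors

variable (X : Scheme.{u}) [IsIntegral X]

/-- The function field `K(X)` of an integral scheme, as a type. -/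
abbrev RatFun : Type u := X.functionField

variable {X}

/-- The units of the local ring at `x`, as a subgroup of `K(X)ˣ`. -/
def localUnits (x : X) : Subgroup (RatFun X)ˣ :=
  (Units.map (algebraMap (X.presheaf.stalk x) (RatFun X)).toMonoidHom).range

/-- A rational function is regular at `x` if it lies in the local ring at `x`. -/
def RegularAt (g : RatFun X) (x : X) : Prop :=
  g ∈ (algebraMap (X.presheaf.stalk x) (RatFun X)).range

variable (X)

/-- Cartier divisors on an integral scheme: global sections of the sheaf `K(X)ˣ / 𝒪_Xˣ`,
i.e. families of germs in `K(X)ˣ / 𝒪_{X,x}ˣ` that are, locally on `X`, given by a single rational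
function. On a smooth variety this is the group of (Weil) divisors. -/
def Divisor : AddSubgroup (∀ x : X, Additive ((RatFun X)ˣ ⧸ localUnits x)) where
  carrier := {D | ∀ x : X, ∃ U : X.Opens, x ∈ U ∧ ∃ g : (RatFun X)ˣ,
    ∀ y ∈ U, D y = Additive.ofMul (QuotientGroup.mk g)}
  zero_mem' := fun x => ⟨⊤, trivial, 1, fun _ _ => rfl⟩
  add_mem' := by
    intro D E hD hE x
    obtain ⟨U, hU, g, hg⟩ := hD x
    obtain ⟨V, hV, h, hh⟩ := hE x
    refine ⟨U ⊓ V, ⟨hU, hV⟩, g * h, fun y hy => ?_⟩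
    rw [Pi.add_apply, hg y hy.1, hh y hy.2]
    rfl
  neg_mem' := by
    intro D hD x
    obtain ⟨U, hU, g, hg⟩ := hD x
    refine ⟨U, hU, g⁻¹, fun y hy => ?_⟩
    rw [Pi.neg_apply, hg y hy]
    rfl

variable {X}

/-- `u` is a local equation of the divisor `D` at `x`. -/
def IsLocalEquation (D : Divisor X) (x : X) (u : (RatFun X)ˣ) : Prop :=
  D.1 x = Additive.ofMul (QuotientGroup.mk u)

/-- The principal divisor of a nonzero rational function. -/
def principal (g : (RatFun X)ˣ) : Divisor X :=
  ⟨fun _ => Additive.ofMul (QuotientGroup.mk g), fun _ => ⟨⊤, trivial, g, fun _ _ => rfl⟩⟩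

/-- Linear equivalence of divisors. -/
def LinEquiv (D E : Divisor X) : Prop :=
  ∃ g : (RatFun X)ˣ, D = E + principal g

/-- A divisor is effective if its local equations are regular. -/
def IsEffective (D : Divisor X) : Prop :=
  ∀ (x : X) (u : (RatFun X)ˣ), IsLocalEquation D x u → RegularAt (u : RatFun X) x

/-- The support of a divisor. -/
def support (D : Divisor X) : Set X := {x | D.1 x ≠ 0}

/-- The closed subscheme of an effective divisor is reduced: local equations generate radical
ideals of the local rings. -/
def HasReducedEquations (D : Divisor X) : Prop :=
  ∀ (x : X) (u : (RatFun X)ˣ) (d : X.presheaf.stalk x), IsLocalEquation D x u →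
    algebraMap (X.presheaf.stalk x) (RatFun X) d = (u : RatFun X) → (Ideal.span {d}).IsRadical

/-- An irreducible divisor (prime divisor): an effective divisor whose closed subscheme is
integral, i.e. reduced and irreducible. -/
def IsIrreducibleDivisor (D : Divisor X) : Prop :=
  IsEffective D ∧ HasReducedEquations D ∧ IsIrreducible (support D)

/-- The rational function `g` is a section of `𝒪_X(D)` at `x`. -/
def SectionAt (D : Divisor X) (g : RatFun X) (x : X) : Prop :=
  ∀ u : (RatFun X)ˣ, IsLocalEquation D x u → RegularAt (g * (u : RatFun X)) x

lemma exists_isLocalEquation (D : Divisor X) (x : X) : ∃ u, IsLocalEquation D x u := by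
  obtain ⟨U, hU, g, hg⟩ := D.2 x
  exact ⟨g, hg x hU⟩

lemma SectionAt.add {D : Divisor X} {g h : RatFun X} {x : X}
    (hg : SectionAt D g x) (hh : SectionAt D h x) : SectionAt D (g + h) x := by
  intro u hu
  rw [RegularAt, add_mul]
  exact add_mem (hg u hu) (hh u hu)

lemma SectionAt.zero (D : Divisor X) (x : X) : SectionAt D 0 x := by
  intro u _
  rw [RegularAt, zero_mul]
  exact zero_mem _

lemma SectionAt.neg {D : Divisor X} {g : RatFun X} {x : X}
    (hg : SectionAt D g x) : SectionAt D (-g) x := by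
  intro u hu
  rw [RegularAt, neg_mul]
  exact neg_mem (hg u hu)

lemma SectionAt.smul {D : Divisor X} {g : RatFun X} {x : X} (hg : SectionAt D g x)
    (r : X.presheaf.stalk x) :
    SectionAt D (algebraMap (X.presheaf.stalk x) (RatFun X) r * g) x := by
  intro u hu
  rw [RegularAt, mul_assoc]
  exact mul_mem ⟨r, rfl⟩ (hg u hu)

/-- The global sections `H⁰(X, 𝒪_X(D))`, as rational functions. -/
def H0 (D : Divisor X) : AddSubgroup (RatFun X) where
  carrier := {g | ∀ x, SectionAt D g x}
  zero_mem' := fun x => .zero D x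
  add_mem' := fun hg hh x => (hg x).add (hh x)
  neg_mem' := fun hg x => (hg x).neg

/-- The zero divisor of a nonzero rational section `s` of `𝒪_X(D)`. -/
def zeroDivisor (D : Divisor X) (s : (RatFun X)ˣ) : Divisor X := D + principal s

end Divisors

section LineBundle

variable {X : Scheme.{u}} [IsIntegral X] (D : Divisor X)

/-- The sections of `𝒪_X(D)` over `U`: rational functions `g` (written as constant functions on
`U`, so that there is only the zero section over `∅`) with `div g + D` effective on `U`. -/
def sections (U : X.Opens) : AddSubgroup (U → RatFun X) where
  carrier := {s | (∀ x y, s x = s y) ∧ ∀ x : U, SectionAt D (s x) x.1}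
  zero_mem' := ⟨fun _ _ => rfl, fun x => .zero D x.1⟩
  add_mem' := fun hs ht => ⟨fun x y => congrArg₂ (· + ·) (hs.1 x y) (ht.1 x y),
    fun x => (hs.2 x).add (ht.2 x)⟩
  neg_mem' := fun hs => ⟨fun x y => congrArg Neg.neg (hs.1 x y), fun x => (hs.2 x).neg⟩

lemma algebraMap_germ_eq {U : X.Opens} (x y : U) (r : Γ(X, U)) :
    algebraMap (X.presheaf.stalk x.1) (RatFun X) (X.presheaf.germ U x.1 x.2 r) =
      algebraMap (X.presheaf.stalk y.1) (RatFun X) (X.presheaf.germ U y.1 y.2 r) := by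
  have : Nonempty U := ⟨x⟩
  rw [Scheme.algebraMap_germ_eq_germToFunctionField, Scheme.algebraMap_germ_eq_germToFunctionField]

instance (U : X.Opens) : Module Γ(X, U) (sections D U) where
  smul r s := ⟨fun x => algebraMap (X.presheaf.stalk x.1) (RatFun X)
      (X.presheaf.germ U x.1 x.2 r) * s.1 x,
    fun x y => congrArg₂ (· * ·) (algebraMap_germ_eq x y r) (s.2.1 x y), fun x => (s.2.2 x).smul _⟩
  one_smul s := Subtype.ext <| funext fun x => by
    change algebraMap _ _ (X.presheaf.germ U x.1 x.2 1) * s.1 x = s.1 x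
    rw [map_one, map_one, one_mul]
  mul_smul r t s := Subtype.ext <| funext fun x => by
    change algebraMap _ _ (X.presheaf.germ U x.1 x.2 (r * t)) * s.1 x =
      algebraMap _ _ (X.presheaf.germ U x.1 x.2 r) *
        (algebraMap _ _ (X.presheaf.germ U x.1 x.2 t) * s.1 x)
    rw [map_mul, map_mul, mul_assoc]
  smul_zero r := Subtype.ext <| funext fun x => mul_zero _
  smul_add r s t := Subtype.ext <| funext fun x => mul_add _ _ _
  add_smul r t s := Subtype.ext <| funext fun x => by
    change algebraMap _ _ (X.presheaf.germ U x.1 x.2 (r + t)) * s.1 x =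
      algebraMap _ _ (X.presheaf.germ U x.1 x.2 r) * s.1 x +
        algebraMap _ _ (X.presheaf.germ U x.1 x.2 t) * s.1 x
    rw [map_add, map_add, add_mul]
  zero_smul s := Subtype.ext <| funext fun x => by
    change algebraMap _ _ (X.presheaf.germ U x.1 x.2 0) * s.1 x = 0
    rw [map_zero, map_zero, zero_mul]

/-- Restriction of sections. -/
def restrictSections {U V : X.Opens} (h : V ≤ U) : sections D U →+ sections D V where
  toFun s := ⟨fun x => s.1 ⟨x.1, h x.2⟩, fun _ _ => s.2.1 _ _, fun x => s.2.2 ⟨x.1, h x.2⟩⟩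
  map_zero' := rfl
  map_add' _ _ := rfl

/-- The presheaf of abelian groups underlying `𝒪_X(D)`. -/
def abPresheaf : TopCat.Presheaf Ab.{u} X where
  obj U := .of (sections D U.unop)
  map f := AddCommGrpCat.ofHom (restrictSections D f.unop.le)

instance (U : X.Opensᵒᵖ) : Module (X.ringCatSheaf.obj.obj U) ((abPresheaf D).obj U) :=
  inferInstanceAs (Module Γ(X, U.unop) (sections D U.unop))

/-- The presheaf of modules underlying `𝒪_X(D)`. -/
def modulePresheaf : X.PresheafOfModules :=
  PresheafOfModules.ofPresheaf (R := X.ringCatSheaf.obj) (abPresheaf D) (by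
    intro U V f r m
    refine Subtype.ext <| funext fun x => ?_
    exact congrArg (fun z => algebraMap (X.presheaf.stalk x.1) (RatFun X) z *
      m.1 ⟨x.1, f.unop.le x.2⟩)
      (X.presheaf.germ_res_apply f.unop x.1 x.2 r).symm)

lemma isSheaf_abPresheaf : (abPresheaf D).IsSheaf := by
  rw [TopCat.Presheaf.isSheaf_iff_isSheaf_comp (forget Ab)]
  apply TopCat.Presheaf.isSheaf_of_isSheafUniqueGluing_types
  intro ι U sf hsf
  have key : ∀ (i j : ι) (x : U i) (y : U j), (sf i).1 x = (sf j).1 y := by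
    intro i j x y
    have hi : genericPoint X ∈ U i :=
      ((genericPoint_spec X).mem_open_set_iff (U i).isOpen).mpr ⟨x.1, trivial, x.2⟩
    have hj : genericPoint X ∈ U j :=
      ((genericPoint_spec X).mem_open_set_iff (U j).isOpen).mpr ⟨y.1, trivial, y.2⟩
    have h := congrFun (congrArg Subtype.val (hsf i j)) ⟨genericPoint X, hi, hj⟩
    exact ((sf i).2.1 x ⟨_, hi⟩).trans (h.trans ((sf j).2.1 ⟨_, hj⟩ y))
  have mem : ∀ x : (iSup U : X.Opens), ∃ i, x.1 ∈ U i := fun x => Opens.mem_iSup.mp x.2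
  choose idx hidx using mem
  refine ⟨⟨fun x => (sf (idx x)).1 ⟨x.1, hidx x⟩, fun x y => key _ _ _ _,
    fun x => (sf (idx x)).2.2 ⟨x.1, hidx x⟩⟩, ?_, ?_⟩
  · intro i
    exact Subtype.ext <| funext fun x => key _ _ _ _
  · intro t ht
    refine Subtype.ext <| funext fun x => ?_
    exact congrFun (congrArg Subtype.val (ht (idx x))) ⟨x.1, hidx x⟩

/-- The invertible sheaf `𝒪_X(D)` of a divisor, as a sheaf of `𝒪_X`-modules. -/
def lineBundle : X.Modules where
  val := modulePresheaf D
  isSheaf := isSheaf_abPresheaf D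

variable (X) in
/-- The structure sheaf as a sheaf of modules over itself. -/
def structureModule : X.Modules := SheafOfModules.unit X.ringCatSheaf

end LineBundle

/-- The ramification locus: the points of `X` at which `φ` is not étale. -/
def ramificationLocus {X Y : Scheme.{u}} (φ : X ⟶ Y) : Set X :=
  {x | ¬ ∃ U : X.Opens, x ∈ U ∧ Etale (U.ι ≫ φ)}

lemma map_genericPoint_specializes {X Y : Scheme.{u}} [IsIntegral X]
    (φ : X ⟶ Y) [IsDominant φ] (y : Y) : φ (genericPoint X) ⤳ y := by
  have h : IsGenericPoint (φ (genericPoint X)) (closure (φ '' Set.univ)) :=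
    (genericPoint_spec X).image φ.continuous
  rw [Set.image_univ, φ.denseRange.closure_range] at h
  exact h.specializes trivial

section Pullback

variable {X Y : Scheme.{u}} [IsIntegral X] [IsIntegral Y] (φ : X ⟶ Y) [IsDominant φ]

/-- The field extension `K(Y) → K(X)` given by a dominant morphism `X ⟶ Y`. -/
def functionFieldMap : RatFun Y →+* RatFun X :=
  (Y.presheaf.stalkSpecializes (map_genericPoint_specializes φ (genericPoint Y)) ≫
    φ.stalkMap (genericPoint X)).hom

lemma functionFieldMap_algebraMap (x : X) (r : Y.presheaf.stalk (φ x)) :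
    functionFieldMap φ (algebraMap (Y.presheaf.stalk (φ x)) (RatFun Y) r) =
      algebraMap (X.presheaf.stalk x) (RatFun X) (φ.stalkMap x r) := by
  have h := φ.stalkSpecializes_stalkMap _ _ ((genericPoint_spec X).specializes (Set.mem_univ x))
  have h' := congrArg (fun k => k.hom r) h
  refine Eq.trans ?_ h'
  change (Y.presheaf.stalkSpecializes _ ≫ Y.presheaf.stalkSpecializes _ ≫
    φ.stalkMap (genericPoint X)).hom r = _
  rw [TopCat.Presheaf.stalkSpecializes_comp_assoc]

/-- The pullback of germs of divisors. -/
def pullbackGerm (x : X) :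
    ((RatFun Y)ˣ ⧸ localUnits (φ x)) →* ((RatFun X)ˣ ⧸ localUnits x) :=
  QuotientGroup.map _ _ (Units.map (functionFieldMap φ).toMonoidHom) (by
    rintro _ ⟨v, rfl⟩
    refine ⟨Units.map (φ.stalkMap x).hom.toMonoidHom v, Units.ext ?_⟩
    exact (functionFieldMap_algebraMap φ x v).symm)

/-- The pullback `φ^* D` of a divisor under a dominant morphism: pull back the local equations. -/
def pullbackDivisor (D : Divisor Y) : Divisor X :=
  ⟨fun x => Additive.ofMul (pullbackGerm φ x (D.1 (φ x)).toMul), by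
    intro x
    obtain ⟨U, hU, g, hg⟩ := D.2 (φ x)
    refine ⟨φ ⁻¹ᵁ U, hU, Units.map (functionFieldMap φ).toMonoidHom g, fun y hy => ?_⟩
    exact congrArg (fun c => Additive.ofMul (pullbackGerm φ y c.toMul)) (hg (φ y) hy)⟩

/-- The degree `[K(X) : K(Y)]` of a dominant morphism of integral schemes. -/
def degree : ℕ :=
  letI := (functionFieldMap φ).toAlgebra
  Module.finrank (RatFun Y) (RatFun X)

/-- `B` is the branch locus of `φ`, as a reduced effective divisor on `Y`: the set of points of
`B` is the image of the ramification locus. -/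
def IsBranchDivisor (B : Divisor Y) : Prop :=
  IsEffective B ∧ HasReducedEquations B ∧ support B = φ '' ramificationLocus φ

end Pullback

end

end DoubleCover

/-! Everything is computed inside the quadratic extension $K(X)/K(Y)$, on which $\iota$ acts as the
nontrivial automorphism $g\mapsto\bar g$. A splitting $\mathcal O_Y(D_1)\oplus\mathcal O_Y(D_2)$ of
$\varphi_*\mathcal O_X(E)$ amounts to two rational functions $e_1,e_2$ on $X$ such that, over each
$y$, the sections of $\mathcal O_X(E)$ are exactly the combinations of $e_1,e_2$ with coefficients
in $\mathcal O_Y(D_1)_y$ and $\mathcal O_Y(D_2)_y$ (`IsFrame`, `exists_isFrame`,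
`IsFrame.nonempty_iso`).

For $E=0$ the determinant $w=e_1\bar e_2-\bar e_1e_2$ is anti-invariant. With $l$ a local equation
of $L$ and $z=lw$, it gives $\varphi_*\mathcal O_X=\mathcal O_Y\oplus\mathcal O_Yz$ with
$z^2=b=l^2W$ and $W=w^2\in K(Y)$ (`exists_coverData`). The divisor of $W$ as a section of $2L$ is
the branch divisor: $\varphi$ is étale where $b$ is a unit and not where $b$ vanishes, and normality
of $X$ makes this divisor reduced (`CoverData.zeroDivisor_eq`). Since global functions are
constants, $F=t^2W$ with $t$ constant. As $f$ is a unit everywhere, (ii) becomes: $W-a^2\in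
H^0(2L-D)$ for some $a\in H^0(L)$.

Let $E=D^+$ and let $d$ be a local equation of $D$, the norm of $E$. For sections $g,h$ of $\mathcal
O_X(E)$ the expression $(g\bar h-\bar gh)d$ is a regular multiple of $z$, and a unit multiple for
suitable $g,h$. Comparing with $e_1,e_2$ gives $D_1+D_2\sim D-L$, which is (i)
(`CoverData.exists_det_of_isFrame`).

For (ii), the section $1$ of $\mathcal O_X(D^+)$ has a nonzero constant coordinate on a trivial
summand, so it can replace a basis vector (`IsFrame.exchange_one`). The other local generator is
then $M=(l/d)(w+a)$. Stability of the module under $z$, read off the coordinates of $zM$, says that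
$a\in H^0(L)$ and $W-a^2\in H^0(2L-D)$ (`CoverData.exists_sub_sq_mem_of_isFrame`).

Conversely, $W-a^2=(w-a)(w+a)$ vanishes on $D^++\iota^*D^+$. Since $D^+$ is prime, one factor $w-b$
with $b=\pm a$ vanishes on $D^+$. Conjugating, $(l/d)(w+b)$ is a section of $\mathcal O_X(D^+)$, and
by Cramer's rule it forms a frame together with $1$ (`CoverData.exists_isFrame_of_sub_sq_mem`). -/

namespace DoubleCover

/-! ### Regular functions and units at a point. -/

section Regular

variable {X : Scheme.{u}} [IsIntegral X]

lemma RegularAt.add {g h : RatFun X} {x : X} (hg : RegularAt g x) (hh : RegularAt h x) :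
    RegularAt (g + h) x := add_mem hg hh

lemma RegularAt.mul {g h : RatFun X} {x : X} (hg : RegularAt g x) (hh : RegularAt h x) :
    RegularAt (g * h) x := mul_mem hg hh

lemma RegularAt.neg {g : RatFun X} {x : X} (hg : RegularAt g x) : RegularAt (-g) x := neg_mem hg

lemma RegularAt.sub {g h : RatFun X} {x : X} (hg : RegularAt g x) (hh : RegularAt h x) :
    RegularAt (g - h) x := sub_mem hg hh

lemma RegularAt.pow {g : RatFun X} {x : X} (hg : RegularAt g x) (n : ℕ) :
    RegularAt (g ^ n) x := pow_mem hg n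

lemma regularAt_zero (x : X) : RegularAt (0 : RatFun X) x := zero_mem _

lemma regularAt_one (x : X) : RegularAt (1 : RatFun X) x := one_mem _

/-- A rational function is a unit at `x` if it is a unit of the local ring at `x`. -/
def UnitAt (g : RatFun X) (x : X) : Prop := g ≠ 0 ∧ RegularAt g x ∧ RegularAt g⁻¹ x

lemma UnitAt.mul {g h : RatFun X} {x : X} (hg : UnitAt g x) (hh : UnitAt h x) :
    UnitAt (g * h) x :=
  ⟨mul_ne_zero hg.1 hh.1, hg.2.1.mul hh.2.1, by rw [mul_inv]; exact hg.2.2.mul hh.2.2⟩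

lemma UnitAt.inv {g : RatFun X} {x : X} (hg : UnitAt g x) : UnitAt g⁻¹ x :=
  ⟨inv_ne_zero hg.1, hg.2.2, by rw [inv_inv]; exact hg.2.1⟩

lemma UnitAt.div {g h : RatFun X} {x : X} (hg : UnitAt g x) (hh : UnitAt h x) :
    UnitAt (g / h) x := by
  rw [div_eq_mul_inv]; exact hg.mul hh.inv

lemma UnitAt.pow {g : RatFun X} {x : X} (hg : UnitAt g x) (n : ℕ) : UnitAt (g ^ n) x :=
  ⟨pow_ne_zero n hg.1, hg.2.1.pow n, by rw [← inv_pow]; exact hg.2.2.pow n⟩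

lemma unitAt_one (x : X) : UnitAt (1 : RatFun X) x :=
  ⟨one_ne_zero, regularAt_one x, by rw [inv_one]; exact regularAt_one x⟩

lemma UnitAt.of_mul_left {g h : RatFun X} {x : X} (hg : RegularAt g x) (hh : RegularAt h x)
    (hgh : UnitAt (g * h) x) : UnitAt g x := by
  have h0 := mul_ne_zero_iff.mp hgh.1
  refine ⟨h0.1, hg, ?_⟩
  have : g⁻¹ = h * (g * h)⁻¹ := by rw [mul_inv]; field_simp [h0.2]
  rw [this]
  exact hh.mul hgh.2.2

lemma RegularAt.mul_unitAt_iff {g h : RatFun X} {x : X} (hh : UnitAt h x) :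
    RegularAt (g * h) x ↔ RegularAt g x := by
  refine ⟨fun H => ?_, fun H => H.mul hh.2.1⟩
  have := H.mul hh.2.2
  rwa [mul_assoc, mul_inv_cancel₀ hh.1, mul_one] at this

lemma unitAt_algebraMap_iff {x : X} (r : X.presheaf.stalk x) :
    UnitAt (algebraMap (X.presheaf.stalk x) (RatFun X) r) x ↔ IsUnit r := by
  have inj := IsFractionRing.injective (X.presheaf.stalk x) (RatFun X)
  constructor
  · rintro ⟨h0, -, s, hs⟩
    refine IsUnit.of_mul_eq_one s (inj ?_)
    rw [map_mul, hs, map_one, mul_inv_cancel₀ h0]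
  · intro hr
    have := hr.map (algebraMap (X.presheaf.stalk x) (RatFun X))
    refine ⟨this.ne_zero, ⟨r, rfl⟩, ⟨hr.unit⁻¹.1, ?_⟩⟩
    rw [eq_comm, inv_eq_iff_eq_inv, eq_comm]
    refine inv_eq_of_mul_eq_one_right ?_
    rw [← map_mul]
    simp

lemma UnitAt.or_of_add {g h : RatFun X} {x : X} (hg : RegularAt g x) (hh : RegularAt h x)
    (H : UnitAt (g + h) x) : UnitAt g x ∨ UnitAt h x := by
  obtain ⟨r, rfl⟩ := hg
  obtain ⟨s, rfl⟩ := hh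
  have H' : UnitAt (algebraMap (X.presheaf.stalk x) (RatFun X) r + algebraMap _ _ s) x := H
  rw [← map_add, unitAt_algebraMap_iff] at H'
  rcases IsLocalRing.isUnit_or_isUnit_of_isUnit_add H' with h | h
  · exact .inl ((unitAt_algebraMap_iff r).mpr h)
  · exact .inr ((unitAt_algebraMap_iff s).mpr h)

lemma RegularAt.exists_open {g : RatFun X} {x : X} (hg : RegularAt g x) :
    ∃ U : X.Opens, ∃ hx : x ∈ U, ∃ r : Γ(X, U),
      algebraMap _ (RatFun X) (X.presheaf.germ U x hx r) = g := by
  obtain ⟨r, rfl⟩ := hg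
  obtain ⟨U, hU, s, rfl⟩ := X.presheaf.exists_germ_eq r
  exact ⟨U, hU, s, rfl⟩

lemma regularAt_germ {U : X.Opens} {x y : X} (hx : x ∈ U) (hy : y ∈ U) (r : Γ(X, U)) :
    RegularAt (algebraMap _ (RatFun X) (X.presheaf.germ U x hx r)) y :=
  ⟨_, (algebraMap_germ_eq (⟨x, hx⟩ : U) ⟨y, hy⟩ r).symm⟩

lemma RegularAt.eventually {g : RatFun X} {x : X} (hg : RegularAt g x) :
    ∃ U : X.Opens, x ∈ U ∧ ∀ y ∈ U, RegularAt g y := by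
  obtain ⟨U, hU, r, rfl⟩ := hg.exists_open
  exact ⟨U, hU, fun y hy => regularAt_germ hU hy r⟩

lemma RegularAt.specializes {g : RatFun X} {x y : X} (h : y ⤳ x) (hg : RegularAt g x) :
    RegularAt g y := by
  obtain ⟨U, hU, H⟩ := hg.eventually
  exact H y (h.mem_open U.isOpen hU)

lemma UnitAt.specializes {g : RatFun X} {x y : X} (h : y ⤳ x) (hg : UnitAt g x) :
    UnitAt g y := ⟨hg.1, hg.2.1.specializes h, hg.2.2.specializes h⟩

lemma genericPoint_mem {U : X.Opens} {x : X} (hx : x ∈ U) : genericPoint X ∈ U :=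
  ((genericPoint_spec X).mem_open_set_iff U.isOpen).mpr ⟨x, trivial, hx⟩

lemma regularAt_genericPoint (g : RatFun X) : RegularAt g (genericPoint X) := by
  refine ⟨g, ?_⟩
  change (X.presheaf.stalkSpecializes _).hom g = g
  rw [TopCat.Presheaf.stalkSpecializes_refl]
  rfl

end Regular

/-! ### Calculus of local equations of divisors. -/

section Equations

variable {X : Scheme.{u}} [IsIntegral X]

lemma mem_localUnits_iff {x : X} (v : (RatFun X)ˣ) :
    v ∈ localUnits x ↔ UnitAt (v : RatFun X) x := by
  constructor
  · rintro ⟨r, rfl⟩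
    exact (unitAt_algebraMap_iff _).mpr r.isUnit
  · intro H
    obtain ⟨r, hr⟩ := H.2.1
    rw [← hr] at H
    have hu := (unitAt_algebraMap_iff _).mp H
    exact ⟨hu.unit, Units.ext hr⟩

lemma IsLocalEquation.iff_unitAt {D : Divisor X} {x : X} {u v : (RatFun X)ˣ}
    (hu : IsLocalEquation D x u) :
    IsLocalEquation D x v ↔ UnitAt ((v : RatFun X) / (u : RatFun X)) x := by
  have : (v : RatFun X) / (u : RatFun X) = ((u⁻¹ * v : (RatFun X)ˣ) : RatFun X) := by
    rw [Units.val_mul, Units.val_inv_eq_inv_val, div_eq_inv_mul]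
  rw [this, ← mem_localUnits_iff, ← QuotientGroup.eq]
  unfold IsLocalEquation at hu ⊢
  rw [hu]
  exact Additive.ofMul.apply_eq_iff_eq

lemma IsLocalEquation.unitAt_div {D : Divisor X} {x : X} {u v : (RatFun X)ˣ}
    (hu : IsLocalEquation D x u) (hv : IsLocalEquation D x v) :
    UnitAt ((v : RatFun X) / (u : RatFun X)) x := hu.iff_unitAt.mp hv

lemma IsLocalEquation.sectionAt_iff {D : Divisor X} {x : X} {u : (RatFun X)ˣ}
    (hu : IsLocalEquation D x u) (g : RatFun X) :
    SectionAt D g x ↔ RegularAt (g * (u : RatFun X)) x := by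
  refine ⟨fun h => h u hu, fun h v hv => ?_⟩
  have := h.mul (hu.unitAt_div hv).2.1
  rwa [show g * (u : RatFun X) * ((v : RatFun X) / (u : RatFun X)) = g * (v : RatFun X) by
    field_simp [u.ne_zero]] at this

lemma IsLocalEquation.eventually {D : Divisor X} {x : X} {u : (RatFun X)ˣ}
    (hu : IsLocalEquation D x u) :
    ∃ U : X.Opens, x ∈ U ∧ ∀ y ∈ U, IsLocalEquation D y u := by
  obtain ⟨U, hU, g, hg⟩ := D.2 x
  have hgx : IsLocalEquation D x g := hg x hU
  have h := hgx.unitAt_div hu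
  obtain ⟨V, hV, hV'⟩ := h.2.1.eventually
  obtain ⟨W, hW, hW'⟩ := h.2.2.eventually
  refine ⟨U ⊓ V ⊓ W, ⟨⟨hU, hV⟩, hW⟩, fun y hy => ?_⟩
  exact (show IsLocalEquation D y g from hg y hy.1.1).iff_unitAt.mpr
    ⟨h.1, hV' y hy.1.2, hW' y hy.2⟩

lemma SectionAt.eventually {D : Divisor X} {x : X} {g : RatFun X} (hg : SectionAt D g x) :
    ∃ U : X.Opens, x ∈ U ∧ ∀ y ∈ U, SectionAt D g y := by
  obtain ⟨u, hu⟩ := exists_isLocalEquation D x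
  obtain ⟨U, hU, hU'⟩ := hu.eventually
  obtain ⟨V, hV, hV'⟩ := (hg u hu).eventually
  exact ⟨U ⊓ V, ⟨hU, hV⟩, fun y hy => ((hU' y hy.1).sectionAt_iff g).mpr (hV' y hy.2)⟩

lemma sectionAt_genericPoint (D : Divisor X) (g : RatFun X) : SectionAt D g (genericPoint X) :=
  fun _ _ => regularAt_genericPoint _

lemma IsLocalEquation.add {D E : Divisor X} {x : X} {u v : (RatFun X)ˣ}
    (hu : IsLocalEquation D x u) (hv : IsLocalEquation E x v) :
    IsLocalEquation (D + E) x (u * v) := by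
  unfold IsLocalEquation at *
  change D.1 x + E.1 x = _
  rw [hu, hv]
  rfl

lemma IsLocalEquation.neg {D : Divisor X} {x : X} {u : (RatFun X)ˣ}
    (hu : IsLocalEquation D x u) : IsLocalEquation (-D) x u⁻¹ := by
  unfold IsLocalEquation at *
  change - D.1 x = _
  rw [hu]
  rfl

lemma IsLocalEquation.sub {D E : Divisor X} {x : X} {u v : (RatFun X)ˣ}
    (hu : IsLocalEquation D x u) (hv : IsLocalEquation E x v) :
    IsLocalEquation (D - E) x (u * v⁻¹) := by
  rw [sub_eq_add_neg]
  exact hu.add hv.neg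

lemma IsLocalEquation.two_nsmul {D : Divisor X} {x : X} {u : (RatFun X)ˣ}
    (hu : IsLocalEquation D x u) : IsLocalEquation ((2 : ℕ) • D) x (u * u) := by
  rw [_root_.two_nsmul]
  exact hu.add hu

lemma isLocalEquation_principal (g : (RatFun X)ˣ) (x : X) :
    IsLocalEquation (principal g) x g := rfl

lemma isLocalEquation_zero (x : X) : IsLocalEquation (0 : Divisor X) x 1 := rfl

lemma sectionAt_zero_iff (g : RatFun X) (x : X) :
    SectionAt (0 : Divisor X) g x ↔ RegularAt g x := by
  rw [(isLocalEquation_zero x).sectionAt_iff, Units.val_one, mul_one]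

lemma Divisor.ext_of_isLocalEquation {D E : Divisor X}
    (h : ∀ x, ∃ u, IsLocalEquation D x u ∧ IsLocalEquation E x u) : D = E := by
  refine Subtype.ext (funext fun x => ?_)
  obtain ⟨u, hD, hE⟩ := h x
  exact hD.trans hE.symm

lemma IsLocalEquation.mem_support_iff {D : Divisor X} {x : X} {u : (RatFun X)ˣ}
    (hu : IsLocalEquation D x u) : x ∈ support D ↔ ¬ UnitAt (u : RatFun X) x := by
  rw [support, Set.mem_ofPred_eq, not_iff_not, ← mem_localUnits_iff]
  unfold IsLocalEquation at hu
  rw [hu]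
  exact QuotientGroup.eq_one_iff u

end Equations

/-! ### Pulling back rational functions and divisors. -/

section FunctionFieldMap

variable {X Y Z : Scheme.{u}} [IsIntegral X] [IsIntegral Y] [IsIntegral Z]

lemma ringHom_ext_stalk {K : Type*} [Field K] (y : Y) {a b : RatFun Y →+* K}
    (h : ∀ r : Y.presheaf.stalk y, a (algebraMap _ _ r) = b (algebraMap _ _ r)) : a = b := by
  ext k
  obtain ⟨p, q, hq, rfl⟩ := IsFractionRing.div_surjective (A := Y.presheaf.stalk y) k
  rw [map_div₀, map_div₀, h, h]

lemma functionFieldMap_comp (f : X ⟶ Y) (g : Y ⟶ Z) (k : X ⟶ Z) (hk : f ≫ g = k)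
    [IsDominant f] [IsDominant g] [IsDominant k] (r : RatFun Z) :
    functionFieldMap k r = functionFieldMap f (functionFieldMap g r) := by
  subst hk
  have : functionFieldMap (f ≫ g) = (functionFieldMap f).comp (functionFieldMap g) := by
    let x : X := genericPoint X
    refine ringHom_ext_stalk (g (f x)) fun r => ?_
    rw [RingHom.comp_apply, functionFieldMap_algebraMap g (f x) r,
      functionFieldMap_algebraMap f x]
    refine (functionFieldMap_algebraMap (f ≫ g) x r).trans ?_
    congr 1
    exact congrArg (fun k => k.hom r) (Scheme.Hom.stalkMap_comp f g x)
  rw [this, RingHom.comp_apply]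

variable (φ : X ⟶ Y) [IsDominant φ]

lemma RegularAt.map {g : RatFun Y} {x : X} (hg : RegularAt g (φ x)) :
    RegularAt (functionFieldMap φ g) x := by
  obtain ⟨r, rfl⟩ := hg
  exact ⟨_, (functionFieldMap_algebraMap φ x r).symm⟩

lemma UnitAt.map {g : RatFun Y} {x : X} (hg : UnitAt g (φ x)) :
    UnitAt (functionFieldMap φ g) x :=
  ⟨(map_ne_zero _).mpr hg.1, hg.2.1.map φ, by rw [← map_inv₀]; exact hg.2.2.map φ⟩

/-- Maps on stalks are local homomorphisms. -/
lemma UnitAt.of_map {g : RatFun Y} {x : X} (hg : RegularAt g (φ x))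
    (h : UnitAt (functionFieldMap φ g) x) : UnitAt g (φ x) := by
  obtain ⟨r, rfl⟩ := hg
  rw [functionFieldMap_algebraMap, unitAt_algebraMap_iff] at h
  exact (unitAt_algebraMap_iff r).mpr (isUnit_of_map_unit (φ.stalkMap x).hom r h)

lemma IsLocalEquation.pullback {D : Divisor Y} {x : X} {u : (RatFun Y)ˣ}
    (hu : IsLocalEquation D (φ x) u) :
    IsLocalEquation (pullbackDivisor φ D) x (Units.map (functionFieldMap φ).toMonoidHom u) := by
  unfold IsLocalEquation at *
  exact congrArg (fun c => Additive.ofMul (pullbackGerm φ x c.toMul)) hu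

end FunctionFieldMap

lemma exists_point_of_prime {X : Scheme.{u}} {U : X.Opens} (hU : IsAffineOpen U) {x : X} (hx : x ∈ U)
    (q : Ideal Γ(X, U)) [hq : q.IsPrime] (hqx : q ≤ (hU.primeIdealOf ⟨x, hx⟩).asIdeal) :
    ∃ y : X, ∃ hy : y ∈ U, y ⤳ x ∧ (hU.primeIdealOf ⟨y, hy⟩).asIdeal = q := by
  let Q : PrimeSpectrum Γ(X, U) := ⟨q, hq⟩
  have hy : hU.fromSpec Q ∈ U := by
    have : hU.fromSpec Q ∈ Set.range hU.fromSpec := ⟨Q, rfl⟩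
    rwa [hU.range_fromSpec] at this
  refine ⟨hU.fromSpec Q, hy, ?_, ?_⟩
  · have h : Q ⤳ hU.primeIdealOf ⟨x, hx⟩ := (PrimeSpectrum.le_iff_specializes _ _).mp hqx
    have := h.map hU.fromSpec.continuous
    rwa [hU.fromSpec_primeIdealOf] at this
  · have : hU.primeIdealOf ⟨hU.fromSpec Q, hy⟩ = Q :=
      hU.fromSpec.isOpenEmbedding.injective (hU.fromSpec_primeIdealOf _)
    rw [this]

/-! ### Rational functions on an affine open set, and their denominators. -/

section Affine

variable {X : Scheme.{u}} [IsIntegral X]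

/-- The rational function defined by a section over a nonempty open set. -/
noncomputable abbrev toRat {U : X.Opens} {x : X} (hx : x ∈ U) : Γ(X, U) →+* RatFun X :=
  (X.presheaf.germ U (genericPoint X) (genericPoint_mem hx)).hom

lemma algebraMap_germ {U : X.Opens} {x y : X} (hx : x ∈ U) (hy : y ∈ U) (r : Γ(X, U)) :
    algebraMap _ (RatFun X) (X.presheaf.germ U y hy r) = toRat hx r := by
  have : Nonempty U := ⟨⟨x, hx⟩⟩
  exact Scheme.algebraMap_germ_eq_germToFunctionField X hy r

lemma regularAt_toRat {U : X.Opens} {x y : X} (hx : x ∈ U) (hy : y ∈ U) (r : Γ(X, U)) :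
    RegularAt (toRat hx r) y := ⟨_, algebraMap_germ hx hy r⟩

lemma toRat_injective {U : X.Opens} {x : X} (hx : x ∈ U) : Function.Injective (toRat hx) :=
  germ_injective_of_isIntegral (X := X) _ (genericPoint_mem hx)

lemma unitAt_toRat_iff {U : X.Opens} (hU : IsAffineOpen U) {x y : X} (hx : x ∈ U) (hy : y ∈ U)
    (r : Γ(X, U)) : UnitAt (toRat hx r) y ↔ r ∉ (hU.primeIdealOf ⟨y, hy⟩).asIdeal := by
  rw [← algebraMap_germ hx hy, unitAt_algebraMap_iff]
  let _ : Algebra Γ(X, U) (X.presheaf.stalk y) :=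
    TopCat.Presheaf.algebra_section_stalk X.presheaf (⟨y, hy⟩ : U)
  have := hU.isLocalization_stalk ⟨y, hy⟩
  exact IsLocalization.AtPrime.isUnit_to_map_iff (X.presheaf.stalk y)
    (hU.primeIdealOf ⟨y, hy⟩).asIdeal r

lemma RegularAt.exists_div {U : X.Opens} (hU : IsAffineOpen U) {x y : X} (hx : x ∈ U) (hy : y ∈ U)
    {g : RatFun X} (hg : RegularAt g y) :
    ∃ a s : Γ(X, U), UnitAt (toRat hx s) y ∧ g = toRat hx a / toRat hx s := by
  obtain ⟨r, rfl⟩ := hg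
  let _ : Algebra Γ(X, U) (X.presheaf.stalk y) :=
    TopCat.Presheaf.algebra_section_stalk X.presheaf (⟨y, hy⟩ : U)
  have := hU.isLocalization_stalk ⟨y, hy⟩
  obtain ⟨⟨a, s⟩, h⟩ := IsLocalization.surj (hU.primeIdealOf ⟨y, hy⟩).asIdeal.primeCompl r
  have hs : UnitAt (toRat hx (s : Γ(X, U))) y := (unitAt_toRat_iff hU hx hy _).mpr s.2
  refine ⟨a, s, hs, ?_⟩
  rw [eq_div_iff hs.1, ← algebraMap_germ hx hy, ← algebraMap_germ hx hy, ← map_mul]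
  exact congrArg _ h

/-- If `h` is regular at all generizations of `x` at which `s` is a unit, then `s ^ n * h` is
regular at `x` for some `n`. -/
lemma exists_pow_mul_regularAt {x : X} {s h : RatFun X} (hs : RegularAt s x)
    (H : ∀ y, y ⤳ x → UnitAt s y → RegularAt h y) : ∃ n : ℕ, RegularAt (s ^ n * h) x := by
  obtain ⟨_, ⟨U, hU, rfl⟩, hx, -⟩ :=
    X.isBasis_affineOpens.exists_subset_of_mem_open (Set.mem_univ x) isOpen_univ
  replace hU : IsAffineOpen U := hU
  replace hx : x ∈ U := hx
  obtain ⟨a, t, ht, rfl⟩ := hs.exists_div hU hx hx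
  let den : Ideal Γ(X, U) :=
    { carrier := {r | ∃ c, toRat hx r * h = toRat hx c}
      zero_mem' := ⟨0, by simp⟩
      add_mem' := by
        rintro r r' ⟨c, hc⟩ ⟨c', hc'⟩
        exact ⟨c + c', by rw [map_add, map_add, add_mul, hc, hc']⟩
      smul_mem' := by
        rintro b r ⟨c, hc⟩
        exact ⟨b * c, by rw [smul_eq_mul, map_mul, map_mul, mul_assoc, hc]⟩ }
  let P := (hU.primeIdealOf ⟨x, hx⟩).asIdeal
  -- If no denominator of `h` has the form $a^nv$ with $v\notin P$, a prime $q$ containing `den`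
  -- avoids all these elements. It is a generization of `x` at which `s` is a unit but `h` is not
  -- regular, contrary to `H`. Otherwise $n$ is the required exponent.
  by_cases hd : Disjoint (den : Set Γ(X, U)) (Submonoid.powers a ⊔ P.primeCompl : Submonoid Γ(X, U))
  · exfalso
    obtain ⟨q, hq, hle, hdis⟩ := Ideal.exists_le_prime_disjoint _ _ hd
    have hqP : q ≤ P := by
      intro r hr
      by_contra hrP
      exact Set.disjoint_left.mp hdis hr
        ((le_sup_right : _ ≤ Submonoid.powers a ⊔ P.primeCompl) hrP)
    have haq : a ∉ q := fun hr => Set.disjoint_left.mp hdis hr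
        ((le_sup_left : _ ≤ Submonoid.powers a ⊔ P.primeCompl) (Submonoid.mem_powers a))
    obtain ⟨y, hy, hyx, rfl⟩ := exists_point_of_prime hU hx q hqP
    have hh := H y hyx (((unitAt_toRat_iff hU hx hy a).mpr haq).div (ht.specializes hyx))
    obtain ⟨c, d, hd', rfl⟩ := hh.exists_div hU hx hy
    refine (unitAt_toRat_iff hU hx hy d).mp hd' (hle ⟨c, ?_⟩)
    exact mul_div_cancel₀ _ hd'.1
  · obtain ⟨r, ⟨c, hc⟩, hr⟩ := Set.not_disjoint_iff.mp hd
    obtain ⟨_, ⟨n, rfl⟩, v, hv, rfl⟩ := Submonoid.mem_sup.mp hr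
    have hv' : UnitAt (toRat hx v) x := (unitAt_toRat_iff hU hx hx v).mpr hv
    refine ⟨n, ?_⟩
    have : (toRat hx a / toRat hx t) ^ n * h =
        toRat hx c * ((toRat hx v)⁻¹ * (toRat hx t ^ n)⁻¹) := by
      rw [← hc, map_mul]
      simp only [map_pow]
      rw [div_pow]
      field_simp [hv'.1, ht.1]
    rw [this]
    exact (regularAt_toRat hx hx c).mul (hv'.inv.2.1.mul (ht.pow n).inv.2.1)

/-- A basis of neighbourhoods by unit loci, inside an affine open set. -/
lemma exists_toRat_unitAt {U V : X.Opens} (hU : IsAffineOpen U) {x : X} (hx : x ∈ U) (hV : x ∈ V) :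
    ∃ s : Γ(X, U), UnitAt (toRat hx s) x ∧ ∀ y ∈ U, UnitAt (toRat hx s) y → y ∈ V := by
  obtain ⟨s, hs, hxs⟩ := hU.exists_basicOpen_le ⟨x, hV⟩ hx
  refine ⟨s, ?_, fun y hy h => hs ?_⟩
  · rw [← algebraMap_germ hx hx, unitAt_algebraMap_iff]
    exact (X.mem_basicOpen _ _ hx).mp hxs
  · rw [← algebraMap_germ hx hy, unitAt_algebraMap_iff] at h
    exact (X.mem_basicOpen _ _ hy).mpr h

end Affine

/-! ### From pointwise regularity to sections. -/

section Gluing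

variable {X : Scheme.{u}} [IsIntegral X]

/-- A rational function that is regular on `U` comes from a section over `U`. -/
lemma exists_section_of_regularAt {U : X.Opens} {x : X} (hx : x ∈ U) {g : RatFun X}
    (hg : ∀ y ∈ U, RegularAt g y) : ∃ r : Γ(X, U), toRat hx r = g := by
  have h : ∀ y : U, ∃ V : X.Opens, y.1 ∈ V ∧ V ≤ U ∧ ∃ r : Γ(X, V), ∀ z (hz : z ∈ V),
      toRat hz r = g := by
    intro y
    obtain ⟨W, hW, r, hr⟩ := (hg y y.2).exists_open
    refine ⟨W ⊓ U, ⟨hW, y.2⟩, inf_le_right, X.presheaf.map (homOfLE inf_le_left).op r, ?_⟩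
    intro z hz
    rw [← algebraMap_germ hz (y := y.1) ⟨hW, y.2⟩, ← hr]
    exact congrArg _ (X.presheaf.germ_res_apply (homOfLE inf_le_left) y.1 _ r)
  choose V hyV hVU r hr using h
  have hcover : U ≤ iSup V := fun y hy => Opens.mem_iSup.mpr ⟨⟨y, hy⟩, hyV ⟨y, hy⟩⟩
  obtain ⟨s, hs, -⟩ := X.sheaf.existsUnique_gluing' V U (fun y => homOfLE (hVU y)) hcover r (by
    intro i j
    have hη : genericPoint X ∈ V i ⊓ V j := ⟨genericPoint_mem (hyV i), genericPoint_mem (hyV j)⟩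
    refine toRat_injective hη ?_
    refine (X.presheaf.germ_res_apply (Opens.infLELeft (V i) (V j)) _ hη (r i)).trans ?_
    refine Eq.trans ?_ (X.presheaf.germ_res_apply (Opens.infLERight (V i) (V j)) _ hη (r j)).symm
    exact (hr i _ (hyV i)).trans (hr j _ (hyV j)).symm)
  refine ⟨s, ?_⟩
  have h1 := hs ⟨x, hx⟩
  rw [← hr ⟨x, hx⟩ x (hyV ⟨x, hx⟩), ← h1]
  exact (X.presheaf.germ_res_apply (homOfLE (hVU ⟨x, hx⟩)) _ _ s).symm

end Gluing

/-! ### Morphisms of sheaves of modules, and line bundles as constant families of functions. -/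

section ModuleHom

variable {Y : Scheme.{u}}

/-- A morphism of sheaves of modules from a compatible family of linear maps on sections. -/
noncomputable def moduleHomMk {M N : Y.Modules}
    (f : ∀ V : Y.Opens, M.presheaf.obj (op V) →+ N.presheaf.obj (op V))
    (hf : ∀ (V W : Y.Opens) (i : W ⟶ V) (s : M.presheaf.obj (op V)),
      f W (M.presheaf.map i.op s) = N.presheaf.map i.op (f V s))
    (hl : ∀ (V : Y.Opens) (r : Γ(Y, V)) (s : M.presheaf.obj (op V)), f V (r • s) = r • f V s) :
    M ⟶ N :=
  (⟨PresheafOfModules.homMk (M₁ := M.val) (M₂ := N.val)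
    { app := fun V => AddCommGrpCat.ofHom (f V.unop)
      naturality := by
        intro V W i
        ext s
        exact hf V.unop W.unop i.unop s }
    (fun V r s => hl V.unop r s)⟩ : SheafOfModules.Hom M N)

lemma moduleHom_naturality {M N : Y.Modules} (f : M ⟶ N) {V W : Y.Opens} (i : W ⟶ V)
    (s : M.presheaf.obj (op V)) :
    f.app W (M.presheaf.map i.op s) = N.presheaf.map i.op (f.app V s) :=
  congrArg (fun k => k.hom s) (f.mapPresheaf.naturality i.op)

lemma isIso_of_bijective {M N : Y.Modules} (f : M ⟶ N)
    (h : ∀ V : Y.Opens, Function.Bijective (f.app V)) : IsIso f := by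
  rw [Scheme.Modules.Hom.isIso_iff_isIso_app]
  intro V
  rw [ConcreteCategory.isIso_iff_bijective]
  exact h V

end ModuleHom

section SectionsOfLineBundle

variable {Y : Scheme.{u}} [IsIntegral Y]

/-- The sections of `𝒪_Y(D)` as constant families of rational functions. -/
noncomputable def secEquiv (D : Divisor Y) (V : Y.Opens) : (lineBundle D).presheaf.obj (op V) ≃+ sections D V :=
  AddEquiv.refl _

/-- The value of a section of `𝒪_Y(D)` over `V`. -/
noncomputable def secVal {D : Divisor Y} {V : Y.Opens} (s : (lineBundle D).presheaf.obj (op V)) (y : V) :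
    RatFun Y := (secEquiv D V s).1 y

lemma secVal_smul {D : Divisor Y} {V : Y.Opens} (r : Γ(Y, V))
    (s : (lineBundle D).presheaf.obj (op V)) (y : V) :
    secVal (r • s) y = toRat y.2 r * secVal s y := by
  rw [← algebraMap_germ y.2 y.2]
  rfl

lemma secVal_map {D : Divisor Y} {V W : Y.Opens} (i : W ⟶ V)
    (s : (lineBundle D).presheaf.obj (op V)) (y : W) :
    secVal ((lineBundle D).presheaf.map i.op s) y = secVal s ⟨y.1, i.le y.2⟩ := rfl

lemma secVal_const {D : Divisor Y} {V : Y.Opens} (s : (lineBundle D).presheaf.obj (op V))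
    (y z : V) : secVal s y = secVal s z := (secEquiv D V s).2.1 y z

lemma sectionAt_secVal {D : Divisor Y} {V : Y.Opens} (s : (lineBundle D).presheaf.obj (op V))
    (y z : V) : SectionAt D (secVal s y) z.1 := by
  rw [secVal_const s y z]
  exact (secEquiv D V s).2.2 z

lemma secVal_injective {D : Divisor Y} {V : Y.Opens} {y : Y} (hy : y ∈ V)
    {s t : (lineBundle D).presheaf.obj (op V)} (h : secVal s ⟨y, hy⟩ = secVal t ⟨y, hy⟩) :
    s = t :=
  (secEquiv D V).injective (Subtype.ext (funext fun z =>
    (secVal_const s z ⟨y, hy⟩).trans (h.trans (secVal_const t ⟨y, hy⟩ z))))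

lemma exists_secVal_eq {D : Divisor Y} {V : Y.Opens} {g : RatFun Y}
    (hg : ∀ y ∈ V, SectionAt D g y) :
    ∃ s : (lineBundle D).presheaf.obj (op V), ∀ y : V, secVal s y = g :=
  ⟨(secEquiv D V).symm ⟨fun _ => g, fun _ _ => rfl, fun y => hg y.1 y.2⟩, fun _ => rfl⟩

lemma structureModule_nonempty_iso_lineBundle_zero :
    Nonempty (structureModule Y ≅ lineBundle (0 : Divisor Y)) := by
  let f : structureModule Y ⟶ lineBundle (0 : Divisor Y) := moduleHomMk
    (fun V =>
      { toFun := fun (r : Γ(Y, V)) => (secEquiv 0 V).symm ⟨fun y => toRat y.2 r, fun _ _ => rfl,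
          fun y => (sectionAt_zero_iff _ _).mpr (regularAt_toRat y.2 y.2 r)⟩
        map_zero' := Subtype.ext (funext fun y => map_zero (toRat y.2))
        map_add' := fun r s => Subtype.ext (funext fun y => map_add (toRat y.2) r s) })
    (fun V W i s => Subtype.ext (funext fun y =>
      Y.presheaf.germ_res_apply i _ (genericPoint_mem y.2) s))
    (fun V r s => Subtype.ext (funext fun y => by
      refine (map_mul (toRat y.2) r s).trans ?_
      rw [← algebraMap_germ y.2 y.2 r]
      rfl))
  have : IsIso f := isIso_of_bijective f fun V => by
    constructor
    · intro r s h
      by_cases hV : Nonempty V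
      · obtain ⟨y⟩ := hV
        exact toRat_injective y.2 (congrFun (congrArg Subtype.val h) y)
      · have : V = ⊥ := by
          ext y
          exact ⟨fun hy => (hV ⟨⟨y, hy⟩⟩).elim, fun hy => hy.elim⟩
        subst this
        have : Subsingleton Γ(Y, ⊥) := inferInstance
        exact this.elim (r : Γ(Y, ⊥)) s
    · intro s
      by_cases hV : Nonempty V
      · obtain ⟨y⟩ := hV
        obtain ⟨r, hr⟩ := exists_section_of_regularAt y.2 (g := secVal s y) (fun z hz => by
          rw [← sectionAt_zero_iff]
          have := (secEquiv 0 V s).2.2 ⟨z, hz⟩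
          rwa [(secEquiv 0 V s).2.1 ⟨z, hz⟩ y] at this)
        refine ⟨r, Subtype.ext (funext fun z => ?_)⟩
        exact hr.trans ((secEquiv 0 V s).2.1 _ _)
      · exact ⟨0, Subtype.ext (funext fun z => (hV ⟨z⟩).elim)⟩
  exact ⟨asIso f⟩

end SectionsOfLineBundle

section PushforwardValues

variable {X Y : Scheme.{u}} [IsIntegral X] (φ : X ⟶ Y)

/-- The sections of `φ_* 𝒪_X(E)` as constant families of rational functions. -/
noncomputable def pushEquiv (E : Divisor X) (V : Y.Opens) :
    ((Scheme.Modules.pushforward φ).obj (lineBundle E)).presheaf.obj (op V) ≃+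
      sections E (φ ⁻¹ᵁ V) :=
  AddEquiv.refl _

/-- The value of a section of `φ_* 𝒪_X(E)` over `V`. -/
noncomputable def pushVal {E : Divisor X} {V : Y.Opens}
    (s : ((Scheme.Modules.pushforward φ).obj (lineBundle E)).presheaf.obj (op V))
    (x : (φ ⁻¹ᵁ V : X.Opens)) : RatFun X := (pushEquiv φ E V s).1 x

variable {φ}

lemma pushVal_add {E : Divisor X} {V : Y.Opens}
    (s t : ((Scheme.Modules.pushforward φ).obj (lineBundle E)).presheaf.obj (op V))
    (x : (φ ⁻¹ᵁ V : X.Opens)) : pushVal φ (s + t) x = pushVal φ s x + pushVal φ t x := rfl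

lemma pushVal_map {E : Divisor X} {V W : Y.Opens} (i : W ⟶ V)
    (s : ((Scheme.Modules.pushforward φ).obj (lineBundle E)).presheaf.obj (op V))
    (x : (φ ⁻¹ᵁ W : X.Opens)) :
    pushVal φ (((Scheme.Modules.pushforward φ).obj (lineBundle E)).presheaf.map i.op s) x =
      pushVal φ s ⟨x.1, i.le x.2⟩ := rfl

lemma pushVal_const {E : Divisor X} {V : Y.Opens}
    (s : ((Scheme.Modules.pushforward φ).obj (lineBundle E)).presheaf.obj (op V))
    (x z : (φ ⁻¹ᵁ V : X.Opens)) : pushVal φ s x = pushVal φ s z := (pushEquiv φ E V s).2.1 x z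

lemma sectionAt_pushVal {E : Divisor X} {V : Y.Opens}
    (s : ((Scheme.Modules.pushforward φ).obj (lineBundle E)).presheaf.obj (op V))
    (x z : (φ ⁻¹ᵁ V : X.Opens)) : SectionAt E (pushVal φ s x) z.1 := by
  rw [pushVal_const s x z]
  exact (pushEquiv φ E V s).2.2 z

lemma pushVal_injective {E : Divisor X} {V : Y.Opens} {x : X} (hx : x ∈ φ ⁻¹ᵁ V)
    {s t : ((Scheme.Modules.pushforward φ).obj (lineBundle E)).presheaf.obj (op V)}
    (h : pushVal φ s ⟨x, hx⟩ = pushVal φ t ⟨x, hx⟩) : s = t :=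
  (pushEquiv φ E V).injective (Subtype.ext (funext fun z =>
    (pushVal_const s z ⟨x, hx⟩).trans (h.trans (pushVal_const t ⟨x, hx⟩ z))))

lemma exists_pushVal_eq {E : Divisor X} {V : Y.Opens} {g : RatFun X}
    (hg : ∀ x ∈ φ ⁻¹ᵁ V, SectionAt E g x) :
    ∃ s : ((Scheme.Modules.pushforward φ).obj (lineBundle E)).presheaf.obj (op V),
      ∀ x : (φ ⁻¹ᵁ V : X.Opens), pushVal φ s x = g :=
  ⟨(pushEquiv φ E V).symm ⟨fun _ => g, fun _ _ => rfl, fun y => hg y.1 y.2⟩, fun _ => rfl⟩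

end PushforwardValues

/-! ### Morphisms to and from a pushforward, in terms of function fields. -/

section Pushforward

variable {X Y : Scheme.{u}} [IsIntegral X] [IsIntegral Y] (φ : X ⟶ Y) [IsDominant φ]

lemma functionFieldMap_toRat {V : Y.Opens} {y : Y} (hy : y ∈ V) {x : X} (hx : x ∈ φ ⁻¹ᵁ V)
    (r : Γ(Y, V)) : functionFieldMap φ (toRat hy r) = toRat hx (φ.app V r) := by
  rw [← algebraMap_germ hy (y := φ x) hx, ← algebraMap_germ hx hx,
    functionFieldMap_algebraMap]
  congr 1
  exact congrArg (fun k => k.hom r) (φ.germ_stalkMap V x hx)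

lemma pushVal_smul {E : Divisor X} {V : Y.Opens} (r : Γ(Y, V))
    (s : ((Scheme.Modules.pushforward φ).obj (lineBundle E)).presheaf.obj (op V))
    (x : (φ ⁻¹ᵁ V : X.Opens)) (y : V) :
    pushVal φ (r • s) x = functionFieldMap φ (toRat y.2 r) * pushVal φ s x := by
  rw [functionFieldMap_toRat φ y.2 x.2]
  exact secVal_smul (D := E) (φ.app V r) s x

variable {φ}

/-- A morphism `𝒪_Y(D) ⟶ φ_* 𝒪_X(E)` is the multiplication by a rational function on `X`. -/
lemma exists_eq_mul {D : Divisor Y} {E : Divisor X}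
    (m : lineBundle D ⟶ (Scheme.Modules.pushforward φ).obj (lineBundle E)) :
    ∃ e : RatFun X, ∀ (V : Y.Opens) (s : (lineBundle D).presheaf.obj (op V))
      (x : (φ ⁻¹ᵁ V : X.Opens)) (y : V),
      pushVal φ (m.app V s) x = functionFieldMap φ (secVal s y) * e := by
  obtain ⟨U, hU, hU'⟩ := (sectionAt_genericPoint D 1).eventually
  obtain ⟨s₀, hs₀⟩ := exists_secVal_eq hU'
  have hdom : ∀ {V : Y.Opens} {y : Y}, y ∈ V → genericPoint X ∈ φ ⁻¹ᵁ V := fun {V} {y} hy =>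
    (map_genericPoint_specializes φ y).mem_open V.isOpen hy
  -- The multiplier is the image of the rational function $1$, a section of $\mathcal O_Y(D)$ over
  -- the nonempty open `U`.
  refine ⟨pushVal φ (m.app U s₀) ⟨genericPoint X, hdom hU⟩, fun V s x y => ?_⟩
  obtain ⟨W, hW, r, hr⟩ := (regularAt_genericPoint (secVal s y)).exists_open
  let T := U ⊓ V ⊓ W
  have hT : genericPoint Y ∈ T := ⟨⟨hU, genericPoint_mem y.2⟩, hW⟩
  let iU : T ⟶ U := homOfLE (inf_le_left.trans inf_le_left)
  let iV : T ⟶ V := homOfLE (inf_le_left.trans inf_le_right)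
  let iW : T ⟶ W := homOfLE inf_le_right
  let r' : Γ(Y, T) := Y.presheaf.map iW.op r
  have hr' : toRat hT r' = secVal s y := by
    rw [← hr, algebraMap_germ hW hW]
    exact Y.presheaf.germ_res_apply iW _ _ r
  -- On a smaller open set any section is a regular function times the section $1$, so linearity
  -- determines its image. Values are constant, so nothing is lost by shrinking.
  have key : (lineBundle D).presheaf.map iV.op s =
      r' • (lineBundle D).presheaf.map iU.op s₀ := by
    apply secVal_injective hT
    rw [secVal_smul, hr', secVal_map, secVal_map, hs₀, mul_one]
    exact secVal_const _ _ _
  have h2 := congrArg (fun k => pushVal φ (m.app T k) ⟨genericPoint X, hdom hT⟩) key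
  dsimp only at h2
  rw [Scheme.Modules.Hom.app_smul, moduleHom_naturality, moduleHom_naturality,
    pushVal_smul φ _ _ _ ⟨_, hT⟩, pushVal_map, pushVal_map, hr'] at h2
  rw [← h2]
  exact pushVal_const _ _ _

/-- The multiplication by a rational function on `X`, as a morphism `𝒪_Y(D) ⟶ φ_* 𝒪_X(E)`. -/
noncomputable def mulHom {D : Divisor Y} {E : Divisor X} (e : RatFun X)
    (he : ∀ (x : X) (g : RatFun Y), SectionAt D g (φ x) →
      SectionAt E (functionFieldMap φ g * e) x) :
    lineBundle D ⟶ (Scheme.Modules.pushforward φ).obj (lineBundle E) :=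
  moduleHomMk
    (fun V =>
      { toFun := fun s => (pushEquiv φ E V).symm
          ⟨fun x => functionFieldMap φ (secVal s ⟨φ x.1, x.2⟩) * e,
            fun _ _ => congrArg (functionFieldMap φ · * e) (secVal_const s _ _), fun x => he x.1 _ (sectionAt_secVal s _ ⟨_, x.2⟩)⟩
        map_zero' := Subtype.ext (funext fun x => by
          change functionFieldMap φ 0 * e = 0
          rw [map_zero, zero_mul])
        map_add' := fun s t => Subtype.ext (funext fun x => by
          change functionFieldMap φ (secVal s _ + secVal t _) * e =
            functionFieldMap φ (secVal s _) * e + functionFieldMap φ (secVal t _) * e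
          rw [map_add, add_mul]) })
    (fun V W i s => rfl)
    (fun V r s => (pushEquiv φ E V).injective (Subtype.ext (funext fun x => by
      refine Eq.trans ?_ (pushVal_smul φ r _ x ⟨φ x.1, x.2⟩).symm
      change functionFieldMap φ (secVal (r • s) _) * e =
        _ * (functionFieldMap φ (secVal s ⟨φ x.1, x.2⟩) * e)
      rw [secVal_smul, map_mul, mul_assoc])))

lemma pushVal_mulHom {D : Divisor Y} {E : Divisor X} (e : RatFun X) (he) (V : Y.Opens)
    (s : (lineBundle D).presheaf.obj (op V)) (x : (φ ⁻¹ᵁ V : X.Opens)) (y : V) :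
    pushVal φ ((mulHom (φ := φ) (E := E) e he).app V s) x =
      functionFieldMap φ (secVal s y) * e := by
  rw [secVal_const s y ⟨φ x.1, x.2⟩]
  rfl

/-- A `K(Y)`-linear functional on `K(X)`, as a morphism `φ_* 𝒪_X(E) ⟶ 𝒪_Y(D)`. -/
noncomputable def functionalHom [Surjective φ] {D : Divisor Y} {E : Divisor X}
    (p : RatFun X →+ RatFun Y) (hlin : ∀ r g, p (functionFieldMap φ r * g) = r * p g)
    (hp : ∀ (y : Y) (g : RatFun X), (∀ x, φ x = y → SectionAt E g x) → SectionAt D (p g) y) :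
    (Scheme.Modules.pushforward φ).obj (lineBundle E) ⟶ lineBundle D :=
  have hmem : ∀ {V : Y.Opens} (y : V), (φ.surjective y.1).choose ∈ φ ⁻¹ᵁ V := fun {V} y => by
    change φ _ ∈ V
    rw [(φ.surjective y.1).choose_spec]
    exact y.2
  moduleHomMk
    (fun V =>
      { toFun := fun s => (secEquiv D V).symm
          ⟨fun y => p (pushVal φ s ⟨_, hmem y⟩),
            fun _ _ => congrArg p (pushVal_const s _ _), fun y => hp y.1 _ fun x hx =>
              sectionAt_pushVal s _ ⟨x, by change φ x ∈ V; rw [hx]; exact y.2⟩⟩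
        map_zero' := Subtype.ext (funext fun x => map_zero p)
        map_add' := fun s t => Subtype.ext (funext fun x => map_add p _ _) })
    (fun V W i s => rfl)
    (fun V r s => (secEquiv D V).injective (Subtype.ext (funext fun y => by
      refine Eq.trans ?_ (secVal_smul r _ y).symm
      change p (pushVal φ (r • s) _) = _ * p (pushVal φ s _)
      rw [pushVal_smul φ _ _ _ y, hlin])))

lemma secVal_functionalHom [Surjective φ] {D : Divisor Y} {E : Divisor X}
    (p : RatFun X →+ RatFun Y) (hlin hp) (V : Y.Opens)
    (s : ((Scheme.Modules.pushforward φ).obj (lineBundle E)).presheaf.obj (op V))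
    (x : (φ ⁻¹ᵁ V : X.Opens)) (y : V) :
    secVal ((functionalHom (φ := φ) (D := D) (E := E) p hlin hp).app V s) y =
      p (pushVal φ s x) := congrArg p (pushVal_const s _ _)

end Pushforward

/-- Finite morphisms are closed: remove from $Y$ the image of the complement of the largest open set
on which `p` holds. -/
lemma exists_open_of_fibre {X Y : Scheme.{u}} (φ : X ⟶ Y) [IsFinite φ] (y : Y)
    (p : X → Prop) (hp : ∀ x, φ x = y → ∃ U : X.Opens, x ∈ U ∧ ∀ z ∈ U, p z) :
    ∃ V : Y.Opens, y ∈ V ∧ ∀ x ∈ φ ⁻¹ᵁ V, p x := by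
  let U : X.Opens := sSup {U | ∀ z ∈ U, p z}
  have hU : ∀ z ∈ U, p z := by
    intro z hz
    obtain ⟨W, hW, hzW⟩ := Opens.mem_sSup.mp hz
    exact hW z hzW
  have hcl : IsClosed (φ '' (U : Set X)ᶜ) := φ.isClosedMap _ U.isOpen.isClosed_compl
  refine ⟨⟨(φ '' (U : Set X)ᶜ)ᶜ, hcl.isOpen_compl⟩, ?_, ?_⟩
  · rintro ⟨x, hx, hxy⟩
    obtain ⟨W, hW, hW'⟩ := hp x hxy
    exact hx (Opens.mem_sSup.mpr ⟨W, hW', hW⟩)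
  · intro x hx
    by_contra hpx
    exact hx ⟨x, fun h => hpx (hU x h), rfl⟩

section SectionOver

variable {X Y : Scheme.{u}} [IsIntegral X] (φ : X ⟶ Y)

/-- The rational functions on `X` that are sections of `𝒪_X(E)` at all points over `y`. -/
def SectionOver (E : Divisor X) (g : RatFun X) (y : Y) : Prop :=
  ∀ x, φ x = y → SectionAt E g x

variable {φ}

lemma SectionOver.eventually [IsFinite φ] {E : Divisor X} {g : RatFun X} {y : Y}
    (h : SectionOver φ E g y) :
    ∃ V : Y.Opens, y ∈ V ∧ ∀ x ∈ φ ⁻¹ᵁ V, SectionAt E g x :=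
  exists_open_of_fibre φ y _ fun x hx => (h x hx).eventually

end SectionOver

/-! ### Splittings of $\varphi_*\mathcal O_X(E)$ as pairs of rational functions. -/

section Frame

variable {X Y : Scheme.{u}} [IsIntegral X] [IsIntegral Y] (φ : X ⟶ Y) [IsDominant φ]

/-- The pair `(e₁, e₂)` identifies `𝒪_Y(D₁) ⊕ 𝒪_Y(D₂)` with `φ_* 𝒪_X(E)`. -/
structure IsFrame (E : Divisor X) (D₁ D₂ : Divisor Y) (e₁ e₂ : RatFun X) : Prop where
  indep : ∀ p q, functionFieldMap φ p * e₁ + functionFieldMap φ q * e₂ = 0 → p = 0 ∧ q = 0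
  sectionOver_iff : ∀ y g, SectionOver φ E g y ↔ ∃ p q, SectionAt D₁ p y ∧ SectionAt D₂ q y ∧
    g = functionFieldMap φ p * e₁ + functionFieldMap φ q * e₂

variable {φ}

/-- The two inclusions of the biproduct are multiplications by rational functions $e_1,e_2$. The
relations between inclusions and projections give independence, and the decomposition of the
identity gives generation. Finiteness extends a section over a fibre to a neighbourhood of that
fibre. -/
theorem exists_isFrame [IsFinite φ] {E : Divisor X} {D₁ D₂ : Divisor Y}
    (i : (Scheme.Modules.pushforward φ).obj (lineBundle E) ≅ lineBundle D₁ ⊞ lineBundle D₂) :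
    ∃ e₁ e₂, IsFrame φ E D₁ D₂ e₁ e₂ := by
  let m₁ := biprod.inl ≫ i.inv
  let m₂ := biprod.inr ≫ i.inv
  let p₁ := i.hom ≫ biprod.fst
  let p₂ := i.hom ≫ biprod.snd
  have h11 : m₁ ≫ p₁ = 𝟙 _ := by simp [m₁, p₁]
  have h12 : m₁ ≫ p₂ = 0 := by simp [m₁, p₂]
  have h21 : m₂ ≫ p₁ = 0 := by simp [m₂, p₁]
  have h22 : m₂ ≫ p₂ = 𝟙 _ := by simp [m₂, p₂]
  have htot : p₁ ≫ m₁ + p₂ ≫ m₂ = 𝟙 _ := by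
    have : p₁ ≫ m₁ + p₂ ≫ m₂ =
        i.hom ≫ (biprod.fst ≫ biprod.inl + biprod.snd ≫ biprod.inr) ≫ i.inv := by
      simp only [Preadditive.add_comp, Preadditive.comp_add, Category.assoc, p₁, p₂, m₁, m₂]
    rw [this, biprod.total, Category.id_comp, i.hom_inv_id]
  obtain ⟨e₁, he₁⟩ := exists_eq_mul m₁
  obtain ⟨e₂, he₂⟩ := exists_eq_mul m₂
  refine ⟨e₁, e₂, ?_, ?_⟩
  · intro p q h
    obtain ⟨U, hU, hU'⟩ := (sectionAt_genericPoint D₁ p).eventually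
    obtain ⟨V, hV, hV'⟩ := (sectionAt_genericPoint D₂ q).eventually
    have hW : genericPoint Y ∈ U ⊓ V := ⟨hU, hV⟩
    obtain ⟨s, hs⟩ := exists_secVal_eq (D := D₁) (V := U ⊓ V) fun y hy => hU' y hy.1
    obtain ⟨t, ht⟩ := exists_secVal_eq (D := D₂) (V := U ⊓ V) fun y hy => hV' y hy.2
    have hx : genericPoint X ∈ φ ⁻¹ᵁ (U ⊓ V) :=
      (map_genericPoint_specializes φ (genericPoint Y)).mem_open (U ⊓ V).isOpen hW
    have h0 : m₁.app (U ⊓ V) s + m₂.app (U ⊓ V) t = 0 := by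
      apply pushVal_injective hx
      rw [pushVal_add, he₁ _ s ⟨_, hx⟩ ⟨_, hW⟩, he₂ _ t ⟨_, hx⟩ ⟨_, hW⟩, hs, ht, h]
      rfl
    have h1 := congrArg (fun k => p₁.app (U ⊓ V) k) h0
    have h2 := congrArg (fun k => p₂.app (U ⊓ V) k) h0
    dsimp only at h1 h2
    rw [map_add, map_zero] at h1 h2
    have a11 : p₁.app (U ⊓ V) (m₁.app (U ⊓ V) s) = s :=
      congrArg (fun k => k.app (U ⊓ V) s) h11
    have a12 : p₂.app (U ⊓ V) (m₁.app (U ⊓ V) s) = 0 :=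
      congrArg (fun k => k.app (U ⊓ V) s) h12
    have a21 : p₁.app (U ⊓ V) (m₂.app (U ⊓ V) t) = 0 :=
      congrArg (fun k => k.app (U ⊓ V) t) h21
    have a22 : p₂.app (U ⊓ V) (m₂.app (U ⊓ V) t) = t :=
      congrArg (fun k => k.app (U ⊓ V) t) h22
    rw [a11, a21, add_zero] at h1
    rw [a12, a22, zero_add] at h2
    constructor
    · rw [← hs ⟨_, hW⟩, h1]; rfl
    · rw [← ht ⟨_, hW⟩, h2]; rfl
  · intro y g
    constructor
    · intro hg
      obtain ⟨V, hy, hV⟩ := hg.eventually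
      obtain ⟨s, hs⟩ := exists_pushVal_eq hV
      have hx : genericPoint X ∈ φ ⁻¹ᵁ V :=
        (map_genericPoint_specializes φ y).mem_open V.isOpen hy
      refine ⟨secVal (p₁.app V s) ⟨y, hy⟩, secVal (p₂.app V s) ⟨y, hy⟩,
        sectionAt_secVal _ _ ⟨y, hy⟩, sectionAt_secVal _ _ ⟨y, hy⟩, ?_⟩
      have h := congrArg (fun k => k.app V s) htot
      have h' : m₁.app V (p₁.app V s) + m₂.app V (p₂.app V s) = s := h
      rw [← hs ⟨_, hx⟩]
      conv_lhs => rw [← h']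
      rw [pushVal_add, he₁ _ _ _ ⟨y, hy⟩, he₂ _ _ _ ⟨y, hy⟩]
    · rintro ⟨p, q, hp, hq, rfl⟩ x hx
      obtain ⟨U, hU, hU'⟩ := hp.eventually
      obtain ⟨V, hV, hV'⟩ := hq.eventually
      obtain ⟨s, hs⟩ := exists_secVal_eq (D := D₁) (V := U ⊓ V) fun y hy => hU' y hy.1
      obtain ⟨t, ht⟩ := exists_secVal_eq (D := D₂) (V := U ⊓ V) fun y hy => hV' y hy.2
      have hx' : x ∈ φ ⁻¹ᵁ (U ⊓ V) := by
        change φ x ∈ U ⊓ V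
        rw [hx]
        exact ⟨hU, hV⟩
      have := sectionAt_pushVal (m₁.app (U ⊓ V) s + m₂.app (U ⊓ V) t) ⟨x, hx'⟩ ⟨x, hx'⟩
      rwa [pushVal_add, he₁ _ s _ ⟨y, hU, hV⟩, he₂ _ t _ ⟨y, hU, hV⟩, hs, ht] at this

/-- The coordinates $P,Q$ with respect to $e_1,e_2$ are $K(Y)$-linear functionals on $K(X)$. They
give the projections, multiplications by $e_1,e_2$ give the inclusions, and all identities can be
checked on rational functions. -/
theorem IsFrame.nonempty_iso [Surjective φ] {E : Divisor X} {D₁ D₂ : Divisor Y}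
    {e₁ e₂ : RatFun X} (h : IsFrame φ E D₁ D₂ e₁ e₂)
    (hspan : ∀ g, ∃ p q, g = functionFieldMap φ p * e₁ + functionFieldMap φ q * e₂) :
    Nonempty ((Scheme.Modules.pushforward φ).obj (lineBundle E) ≅
      lineBundle D₁ ⊞ lineBundle D₂) := by
  choose P Q hPQ using hspan
  have uniq : ∀ p q p' q', functionFieldMap φ p * e₁ + functionFieldMap φ q * e₂ =
      functionFieldMap φ p' * e₁ + functionFieldMap φ q' * e₂ → p = p' ∧ q = q' := by
    intro p q p' q' H
    have := h.indep (p - p') (q - q') (by rw [map_sub, map_sub]; linear_combination H)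
    exact ⟨sub_eq_zero.mp this.1, sub_eq_zero.mp this.2⟩
  have hadd : ∀ g g', P (g + g') = P g + P g' ∧ Q (g + g') = Q g + Q g' := fun g g' =>
    uniq _ _ _ _ (by
      rw [← hPQ, map_add, map_add]
      linear_combination hPQ g + hPQ g')
  have hmul : ∀ r g, P (functionFieldMap φ r * g) = r * P g ∧
      Q (functionFieldMap φ r * g) = r * Q g := fun r g =>
    uniq _ _ _ _ (by
      rw [← hPQ, map_mul, map_mul]
      linear_combination functionFieldMap φ r * hPQ g)
  have hval : ∀ p q, P (functionFieldMap φ p * e₁ + functionFieldMap φ q * e₂) = p ∧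
      Q (functionFieldMap φ p * e₁ + functionFieldMap φ q * e₂) = q := fun p q =>
    uniq _ _ _ _ (hPQ _).symm
  have hmem : ∀ y g, SectionOver φ E g y → SectionAt D₁ (P g) y ∧ SectionAt D₂ (Q g) y := by
    intro y g hg
    obtain ⟨p, q, hp, hq, rfl⟩ := (h.sectionOver_iff y g).mp hg
    rw [(hval p q).1, (hval p q).2]
    exact ⟨hp, hq⟩
  let p₁ : (Scheme.Modules.pushforward φ).obj (lineBundle E) ⟶ lineBundle D₁ :=
    functionalHom (AddMonoidHom.mk' P fun g g' => (hadd g g').1) (fun r g => (hmul r g).1)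
      (fun y g hg => (hmem y g hg).1)
  let p₂ : (Scheme.Modules.pushforward φ).obj (lineBundle E) ⟶ lineBundle D₂ :=
    functionalHom (AddMonoidHom.mk' Q fun g g' => (hadd g g').2) (fun r g => (hmul r g).2)
      (fun y g hg => (hmem y g hg).2)
  let m₁ : lineBundle D₁ ⟶ (Scheme.Modules.pushforward φ).obj (lineBundle E) :=
    mulHom e₁ fun x g hg => (h.sectionOver_iff (φ x) _).mpr
      ⟨g, 0, hg, .zero _ _, by simp⟩ x rfl
  let m₂ : lineBundle D₂ ⟶ (Scheme.Modules.pushforward φ).obj (lineBundle E) :=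
    mulHom e₂ fun x g hg => (h.sectionOver_iff (φ x) _).mpr
      ⟨0, g, .zero _ _, hg, by simp⟩ x rfl
  refine ⟨⟨biprod.lift p₁ p₂, biprod.desc m₁ m₂, ?_, ?_⟩⟩
  · rw [biprod.lift_desc]
    refine Scheme.Modules.hom_ext _ _ fun V => ?_
    ext s
    refine (pushEquiv φ E V).injective (Subtype.ext (funext fun x => ?_))
    change pushVal φ (m₁.app V (p₁.app V s)) x + pushVal φ (m₂.app V (p₂.app V s)) x =
      pushVal φ s x
    have q₁ : secVal (p₁.app V s) ⟨φ x.1, x.2⟩ = P (pushVal φ s x) :=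
      secVal_functionalHom _ _ _ _ _ _ _
    have q₂ : secVal (p₂.app V s) ⟨φ x.1, x.2⟩ = Q (pushVal φ s x) :=
      secVal_functionalHom _ _ _ _ _ _ _
    rw [pushVal_mulHom _ _ _ _ _ ⟨φ x.1, x.2⟩, pushVal_mulHom _ _ _ _ _ ⟨φ x.1, x.2⟩]
    exact (congrArg₂ (fun a b => functionFieldMap φ a * e₁ + functionFieldMap φ b * e₂) q₁
      q₂).trans (hPQ _).symm
  · have key : ∀ {D D' : Divisor Y} (e : RatFun X) (he) (p : RatFun X →+ RatFun Y) (hlin hp)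
        (V : Y.Opens) (s : (lineBundle D).presheaf.obj (op V)) (y : V),
        secVal ((mulHom (φ := φ) (D := D) (E := E) e he ≫
          functionalHom (φ := φ) (D := D') p hlin hp).app V s) y =
            p (functionFieldMap φ (secVal s y) * e) := by
      intro D D' e he p hlin hp V s y
      have hx : genericPoint X ∈ φ ⁻¹ᵁ V :=
        (map_genericPoint_specializes φ y).mem_open V.isOpen y.2
      exact (secVal_functionalHom _ hlin hp _ _ ⟨_, hx⟩ y).trans
        (congrArg p (pushVal_mulHom e he V s ⟨_, hx⟩ y))
    have e11 : m₁ ≫ p₁ = 𝟙 _ := by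
      refine Scheme.Modules.hom_ext _ _ fun V => ?_
      ext s
      refine (secEquiv D₁ V).injective (Subtype.ext (funext fun y => (key _ _ _ _ _ V s y).trans ?_))
      change P (functionFieldMap φ (secVal s y) * e₁) = secVal s y
      simpa using (hval (secVal s y) 0).1
    have e22 : m₂ ≫ p₂ = 𝟙 _ := by
      refine Scheme.Modules.hom_ext _ _ fun V => ?_
      ext s
      refine (secEquiv D₂ V).injective (Subtype.ext (funext fun y => (key _ _ _ _ _ V s y).trans ?_))
      change Q (functionFieldMap φ (secVal s y) * e₂) = secVal s y
      simpa using (hval 0 (secVal s y)).2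
    have e12 : m₁ ≫ p₂ = 0 := by
      refine Scheme.Modules.hom_ext _ _ fun V => ?_
      ext s
      refine (secEquiv D₂ V).injective (Subtype.ext (funext fun y => (key _ _ _ _ _ V s y).trans ?_))
      simpa using (hval (secVal s y) 0).2
    have e21 : m₂ ≫ p₁ = 0 := by
      refine Scheme.Modules.hom_ext _ _ fun V => ?_
      ext s
      refine (secEquiv D₁ V).injective (Subtype.ext (funext fun y => (key _ _ _ _ _ V s y).trans ?_))
      simpa using (hval 0 (secVal s y)).1
    apply biprod.hom_ext <;> apply biprod.hom_ext' <;> simp [e11, e12, e21, e22]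

end Frame

/-! ### Quadratic field extensions and the action of the covering transformation. -/

section DegreeTwo

variable {K L : Type*} [Field K] [Field L] (ψ : K →+* L) (σ : L →+* L)

lemma exists_add_mul_of_finrank_eq_two
    (hdeg : letI := ψ.toAlgebra; Module.finrank K L = 2) {θ : L} (hθ : ∀ r, ψ r ≠ θ) (g : L) :
    ∃ p q, g = ψ p + ψ q * θ := by
  let _ := ψ.toAlgebra
  have hli : LinearIndependent K ![(1 : L), θ] := by
    rw [LinearIndependent.pair_iff' one_ne_zero]
    intro a h
    refine hθ a ?_
    rw [← h, Algebra.smul_def, mul_one]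
    rfl
  have hs := hli.span_eq_top_of_card_eq_finrank (by rw [Fintype.card_fin]; exact hdeg.symm)
  have hg : g ∈ Submodule.span K (Set.range ![(1 : L), θ]) := by rw [hs]; trivial
  rw [Matrix.range_cons, Matrix.range_cons, Matrix.range_empty, Set.union_empty,
    Set.singleton_union, Submodule.mem_span_pair] at hg
  obtain ⟨p, q, h⟩ := hg
  refine ⟨p, q, ?_⟩
  rw [← h, Algebra.smul_def, Algebra.smul_def, mul_one]
  rfl

variable (hdeg : letI := ψ.toAlgebra; Module.finrank K L = 2) (hσ : ∀ r, σ (ψ r) = ψ r)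
  (hne : ∃ g, σ g ≠ g)
include hdeg hσ hne

/-- If $\theta$ is moved by $\sigma$, then $1,\theta$ is a basis, and invariance of $p+q\theta$
forces $q=0$. -/
lemma exists_eq_of_map_eq {g : L} (hg : σ g = g) : ∃ r, g = ψ r := by
  obtain ⟨θ, hθ⟩ := hne
  obtain ⟨p, q, rfl⟩ := exists_add_mul_of_finrank_eq_two ψ hdeg (θ := θ)
    (fun r hr => hθ (by rw [← hr, hσ])) g
  rw [map_add, map_mul, hσ, hσ] at hg
  have : ψ q * (σ θ - θ) = 0 := by linear_combination hg
  rcases mul_eq_zero.mp this with h | h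
  · exact ⟨p, by rw [h]; ring⟩
  · exact (hθ (sub_eq_zero.mp h)).elim

lemma map_map_eq (g : L) : σ (σ g) = g := by
  obtain ⟨θ, hθ⟩ := hne
  have hθ' : ∀ r, ψ r ≠ θ := fun r hr => hθ (by rw [← hr, hσ])
  have key : σ (σ θ) = θ := by
    -- From $\theta^2=p+q\theta$, both $\theta$ and $\sigma\theta\ne\theta$ are roots of one
    -- quadratic over $K$. Hence $\sigma\theta=q-\theta$, and applying $\sigma$ again returns
    -- $\theta$.
    obtain ⟨p, q, h⟩ := exists_add_mul_of_finrank_eq_two ψ hdeg hθ' (θ * θ)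
    have h2 := congrArg σ h
    rw [map_mul, map_add, map_mul, hσ, hσ] at h2
    have h3 : (σ θ - θ) * (σ θ + θ - ψ q) = 0 := by linear_combination h2 - h
    have h4 : σ θ = ψ q - θ := by
      rcases mul_eq_zero.mp h3 with h | h
      · exact (hθ (sub_eq_zero.mp h)).elim
      · linear_combination h
    have h5 := congrArg σ h4
    rw [map_sub, hσ] at h5
    linear_combination h5 - h4
  obtain ⟨p, q, rfl⟩ := exists_add_mul_of_finrank_eq_two ψ hdeg hθ' g
  rw [map_add, map_mul, map_add, map_mul, hσ, hσ, hσ, key]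
  rw [hσ]

end DegreeTwo

section Automorphism

variable {X Y : Scheme.{u}} [IsIntegral X]

lemma specMap_functionFieldMap (f : X ⟶ X) [IsDominant f] :
    Spec.map (CommRingCat.ofHom (functionFieldMap f)) ≫ X.fromSpecStalk (genericPoint X) =
      X.fromSpecStalk (genericPoint X) ≫ f := by
  have : CommRingCat.ofHom (functionFieldMap f) =
      X.presheaf.stalkSpecializes (map_genericPoint_specializes f (genericPoint X)) ≫
        f.stalkMap (genericPoint X) := rfl
  rw [this, Spec.map_comp, Category.assoc, Scheme.SpecMap_stalkSpecializes_fromSpecStalk,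
    Scheme.SpecMap_stalkMap_fromSpecStalk]

/-- If `f` acted trivially on $K(X)$, then `f` and the identity would agree on the spectrum of the
generic stalk, which is dominant in $X$. Separatedness over $Y$ would make them equal. -/
lemma exists_functionFieldMap_ne (φ : X ⟶ Y) [IsSeparated φ] (f : X ⟶ X) [IsDominant f]
    (hf : f ≫ φ = φ) (hne : f ≠ 𝟙 X) : ∃ g, functionFieldMap f g ≠ g := by
  by_contra! h
  apply hne
  have hid : CommRingCat.ofHom (functionFieldMap f) = 𝟙 _ := by
    ext g
    exact h g
  have hdom : IsDominant (X.fromSpecStalk (genericPoint X)) := by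
    refine ⟨?_⟩
    rw [DenseRange, Scheme.range_fromSpecStalk]
    refine Dense.mono (s₁ := {genericPoint X}) ?_ ?_
    · rintro _ rfl
      exact specializes_rfl
    · rw [dense_iff_closure_eq]
      exact genericPoint_closure X
  refine ext_of_isDominant_of_isSeparated φ (by rw [hf, Category.id_comp])
    (X.fromSpecStalk (genericPoint X)) ?_
  rw [← specMap_functionFieldMap, hid, Spec.map_id, Category.id_comp, Category.comp_id]

end Automorphism

/-! ### Normality of smooth schemes. -/

section

open scoped TensorProduct nonZeroDivisors

/-- With $F$ the fraction field of $R$, the domain $S\otimes_RF$ is finite over $F$, hence a field,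
and it is the fraction field of $S$. Formation of integral closure commutes with smooth base change,
and the integral closure of $R$ in $F$ is $R$ itself. -/
theorem isIntegrallyClosed_of_etale (R S : Type*) [CommRing R] [IsDomain R] [IsIntegrallyClosed R]
    [CommRing S] [IsDomain S] [Algebra R S] [Algebra.Etale R S] : IsIntegrallyClosed S := by
  let F := FractionRing R
  let T := S ⊗[R] F
  have hinj : Function.Injective (algebraMap R S) := FaithfulSMul.algebraMap_injective R S
  have hloc : IsLocalization (Algebra.algebraMapSubmonoid S R⁰) T := inferInstance
  have hM : Algebra.algebraMapSubmonoid S R⁰ ≤ S⁰ := by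
    rintro _ ⟨r, hr, rfl⟩
    exact mem_nonZeroDivisors_of_ne_zero
      ((map_ne_zero_iff _ hinj).mpr (nonZeroDivisors.ne_zero hr))
  have hT : IsDomain T := IsLocalization.isDomain_of_le_nonZeroDivisors T hM
  let e : F ⊗[R] S ≃+* T := (Algebra.TensorProduct.comm R F S).toRingEquiv
  have hT' : IsDomain (F ⊗[R] S) := e.toMulEquiv.isDomain T
  have hfin : Module.Finite F (F ⊗[R] S) := Algebra.FormallyUnramified.finite_of_free F _
  have hfield : IsField (F ⊗[R] S) := isField_of_isIntegral_of_isField' (Field.toIsField F)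
  have hfield' : IsField T := e.symm.toMulEquiv.isField hfield
  let _ := hfield'.toField
  have hfrac : IsFractionRing S T := IsFractionRing.of_field S T fun z => by
    obtain ⟨⟨a, b⟩, h⟩ := IsLocalization.surj (Algebra.algebraMapSubmonoid S R⁰) z
    refine ⟨a, b, ?_⟩
    have hb : algebraMap S T b ≠ 0 :=
      (IsLocalization.map_units T b).ne_zero
    rw [eq_div_iff hb, h]
  rw [isIntegrallyClosed_iff T]
  intro x hx
  obtain ⟨t, ht⟩ := (TensorProduct.toIntegralClosure_bijective_of_smooth (R := R) (S := S)
    (B := F)).2 ⟨x, hx⟩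
  have : ∀ t : S ⊗[R] integralClosure R F,
      ∃ s, algebraMap S T s = (TensorProduct.toIntegralClosure R S F t : T) := by
    intro t
    induction t with
    | zero => exact ⟨0, by simp⟩
    | add a b ha hb =>
      obtain ⟨s, hs⟩ := ha
      obtain ⟨s', hs'⟩ := hb
      exact ⟨s + s', by rw [map_add, map_add, hs, hs']; rfl⟩
    | tmul s b =>
      obtain ⟨r, hr⟩ := IsIntegrallyClosed.algebraMap_eq_of_integral (R := R) b.2
      refine ⟨r • s, ?_⟩
      change (r • s) ⊗ₜ[R] (1 : F) = s ⊗ₜ[R] (b : F)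
      rw [TensorProduct.smul_tmul, ← hr, Algebra.smul_def, mul_one]
  obtain ⟨s, hs⟩ := this t
  exact ⟨s, by rw [hs, ht]⟩

lemma isField_sections_spec {k : Type u} [Field k] {U : (Spec (CommRingCat.of k)).Opens}
    {x : Spec (CommRingCat.of k)} (hx : x ∈ U) : IsField Γ(Spec (CommRingCat.of k), U) := by
  have hU : U = ⊤ := by
    ext z
    have : Subsingleton (Spec (CommRingCat.of k)) := inferInstanceAs (Subsingleton (PrimeSpectrum k))
    rw [Subsingleton.elim z x]
    exact ⟨fun _ => trivial, fun _ => hx⟩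
  subst hU
  exact (Scheme.ΓSpecIso (CommRingCat.of k)).commRingCatIsoToRingEquiv.toMulEquiv.isField
    (Field.toIsField k)

/-- A smooth integral scheme over a field is normal: square roots of regular functions are
regular. -/
lemma RegularAt.of_sq {X : Scheme.{u}} [IsIntegral X] {k : Type u} [Field k]
    (s : X ⟶ Spec (CommRingCat.of k)) [Smooth s] {x : X} {h : RatFun X}
    (hh : RegularAt (h ^ 2) x) : RegularAt h x := by
  obtain ⟨U, hU, V, hV, hx, e, hs⟩ := Smooth.exists_isStandardSmooth s x
  have hfield : IsField Γ(Spec (CommRingCat.of k), U) := isField_sections_spec (e hx)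
  -- Locally $X$ is étale over an affine space over a field, whose coordinate ring is integrally
  -- closed. A square root of a regular function is integral once its denominator is cleared.
  obtain ⟨n, φ, -, hφ⟩ := hs.exists_etale_mvPolynomial
  let _ := hfield.toField
  have hdomS : IsDomain Γ(X, V) := (toRat_injective hx).isDomain
  let _ := φ.toAlgebra
  have : Algebra.Etale (MvPolynomial (Fin n) Γ(Spec (CommRingCat.of k), U)) Γ(X, V) := hφ
  have hnormal : IsIntegrallyClosed Γ(X, V) :=
    isIntegrallyClosed_of_etale (MvPolynomial (Fin n) Γ(Spec (CommRingCat.of k), U)) Γ(X, V)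
  obtain ⟨a, t, ht, hat⟩ := hh.exists_div hV hx hx
  have : Nonempty V := ⟨⟨x, hx⟩⟩
  have := functionField_isFractionRing_of_isAffineOpen X V hV
  have hint : IsIntegral Γ(X, V) (toRat hx t * h) := by
    refine IsIntegral.of_pow (n := 2) two_pos ?_
    rw [mul_pow, hat, show toRat hx t ^ 2 * (toRat hx a / toRat hx t) = toRat hx (t * a) by
      rw [map_mul]; field_simp [ht.1]]
    exact isIntegral_algebraMap
  obtain ⟨b, hb⟩ := IsIntegrallyClosed.algebraMap_eq_of_integral (K := RatFun X) hint
  have : h = toRat hx b * (toRat hx t)⁻¹ := by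
    have hb' : toRat hx b = toRat hx t * h := hb
    rw [hb']
    field_simp [ht.1]
  rw [this]
  exact (regularAt_toRat hx hx b).mul ht.inv.2.1

end

/-! ### Étaleness of quadratic algebras, and étale stalk maps. -/

/-- A quadratic extension `R[z]/(z² - b)` with `2` and `b` invertible is étale. -/
theorem etale_of_sq_eq {R A : Type*} [CommRing R] [CommRing A] [Algebra R A] (z : A) (b : R)
    (hz : z * z = algebraMap R A b) (hb : IsUnit b) (h2 : IsUnit (2 : R))
    (hspan : ∀ a, ∃ p q, a = algebraMap R A p + algebraMap R A q * z)
    (hli : ∀ p q, algebraMap R A p + algebraMap R A q * z = 0 → p = 0 ∧ q = 0) :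
    Algebra.Etale R A := by
  let l : R × R →ₗ[R] A :=
    LinearMap.coprod (LinearMap.toSpanSingleton R A 1) (LinearMap.toSpanSingleton R A z)
  have hl : ∀ p q, l (p, q) = algebraMap R A p + algebraMap R A q * z := fun p q => by
    simp [l, Algebra.smul_def]
  have hbij : Function.Bijective l := by
    constructor
    · rw [injective_iff_map_eq_zero]
      rintro ⟨p, q⟩ h
      obtain ⟨rfl, rfl⟩ := hli p q ((hl p q).symm.trans h)
      rfl
    · intro a
      obtain ⟨p, q, rfl⟩ := hspan a
      exact ⟨(p, q), hl p q⟩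
  let e := LinearEquiv.ofBijective l hbij
  have : Module.Free R A := .of_equiv e
  have : Module.Finite R A := .equiv e
  have : Module.FinitePresentation R A := Module.finitePresentation_of_projective R A
  have : Algebra.FinitePresentation R A := inferInstance
  have : Algebra.FormallyUnramified R A := by
    refine ⟨?_⟩
    have hD : ∀ a, KaehlerDifferential.D R A a = 0 := by
      -- Differentiating $z^2=b$ gives $2z\,dz=0$ with $2z$ a unit. Hence all differentials vanish,
      -- and $A$ is unramified as well as free over $R$.
      have h1 : (2 * z) • KaehlerDifferential.D R A z = 0 := by
        have := congrArg (KaehlerDifferential.D R A) hz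
        rw [Derivation.leibniz, Derivation.map_algebraMap, ← add_smul] at this
        rwa [two_mul]
      have hu : IsUnit (2 * z) := by
        refine IsUnit.mul (by
          have := h2.map (algebraMap R A)
          rwa [map_ofNat] at this) ?_
        exact isUnit_of_mul_isUnit_left (hz ▸ hb.map (algebraMap R A))
      have h2 : KaehlerDifferential.D R A z = 0 := hu.smul_eq_zero.mp h1
      intro a
      obtain ⟨p, q, rfl⟩ := hspan a
      rw [map_add, Derivation.leibniz, Derivation.map_algebraMap, Derivation.map_algebraMap, h2]
      simp
    have htop := KaehlerDifferential.span_range_derivation R A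
    have hbot : Submodule.span A (Set.range (KaehlerDifferential.D R A)) = ⊥ := by
      rw [Submodule.span_eq_bot]
      rintro _ ⟨a, rfl⟩
      exact hD a
    rw [hbot] at htop
    exact (Submodule.subsingleton_iff A).mp (subsingleton_of_bot_eq_top htop)
  exact Algebra.Etale.of_formallyUnramified_of_flat

lemma etale_of_app {X Y : Scheme.{u}} (φ : X ⟶ Y) {V : Y.Opens} (hV : IsAffineOpen V)
    (hW : IsAffineOpen (φ ⁻¹ᵁ V)) (h : (φ.app V).hom.Etale) : Etale ((φ ⁻¹ᵁ V).ι ≫ φ) := by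
  rw [← morphismRestrict_ι]
  have : IsAffine V := hV
  have : IsAffine (φ ⁻¹ᵁ V) := hW
  have : Etale (φ ∣_ V) := by
    rw [HasRingHomProperty.iff_of_isAffine (P := @Etale)]
    rw [Scheme.Hom.appTop, Scheme.Hom.app_eq_appLE, morphismRestrict_appLE]
    refine (φ.appLE_congr _ (Scheme.Opens.ι_image_top V)
      (Scheme.Opens.ι_image_top (φ ⁻¹ᵁ V)) (fun f => f.hom.Etale)).mpr ?_
    rwa [← Scheme.Hom.app_eq_appLE]
  infer_instance

/-- The stalk map is local, formally unramified and essentially of finite type. This is the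
obstruction that will show that branch points are not étale. -/
lemma maximalIdeal_eq_map_of_etale {X Y : Scheme.{u}} (φ : X ⟶ Y) [LocallyOfFiniteType φ] {x : X}
    (U : X.Opens) (hx : x ∈ U) (h : Etale (U.ι ≫ φ)) :
    (IsLocalRing.maximalIdeal (Y.presheaf.stalk (φ x))).map (φ.stalkMap x).hom =
      IsLocalRing.maximalIdeal (X.presheaf.stalk x) := by
  have h1 := FormallyUnramified.stalkMap (U.ι ≫ φ) ⟨x, hx⟩
  have h2 : (φ.stalkMap x).hom.FormallyUnramified := by
    have h4 := Scheme.Hom.stalkMap_comp U.ι φ ⟨x, hx⟩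
    rw [h4] at h1
    let x' : U.toScheme := ⟨x, hx⟩
    have : IsIso (U.ι.stalkMap x') := inferInstance
    exact (RingHom.FormallyUnramified.respectsIso.cancel_right_isIso (φ.stalkMap (U.ι x'))
      (U.ι.stalkMap x')).mp h1
  have h3 : (φ.stalkMap x).hom.EssFiniteType := LocallyOfFiniteType.stalkMap φ x
  algebraize [(φ.stalkMap x).hom]
  have : IsLocalHom (algebraMap (Y.presheaf.stalk (φ x)) (X.presheaf.stalk x)) :=
    inferInstanceAs (IsLocalHom (φ.stalkMap x).hom)
  exact Algebra.FormallyUnramified.map_maximalIdeal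

lemma apply_of_comp_eq {X Y : Scheme.{u}} {φ : X ⟶ Y} {ι : X ⟶ X} (h : ι ≫ φ = φ) (x : X) :
    φ (ι x) = φ x := by
  rw [← Scheme.Hom.comp_apply, h]

/-! ### The anti-invariant generator $w$ of the double cover. -/

section CoverData

variable {X Y : Scheme.{u}} [IsIntegral X] [IsIntegral Y]

/-- The function `w` on `X` with `φ_* 𝒪_X = 𝒪_Y ⊕ 𝒪_Y(-L) w` as algebras, `w` being
anti-invariant under the covering transformation `ι`. -/
structure CoverData (φ ι : _) [IsDominant (φ : X ⟶ Y)] [IsDominant (ι : X ⟶ X)] (L : Divisor Y)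
    (w : RatFun X) : Prop where
  comp : ι ≫ φ = φ
  map_map : ∀ g, functionFieldMap ι (functionFieldMap ι g) = g
  fixed : ∀ g, functionFieldMap ι g = g → ∃ r, g = functionFieldMap φ r
  map_w : functionFieldMap ι w = -w
  w_ne_zero : w ≠ 0
  unitAt_two : ∀ y : Y, UnitAt (2 : RatFun Y) y
  regular_iff : ∀ y g, (∀ x, φ x = y → RegularAt g x) ↔
    ∃ p q, RegularAt p y ∧ SectionAt (-L) q y ∧
      g = functionFieldMap φ p + functionFieldMap φ q * w

lemma IsLocalEquation.sectionAt_neg_iff {L : Divisor Y} {y : Y} {l : (RatFun Y)ˣ}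
    (hl : IsLocalEquation L y l) (q : RatFun Y) :
    SectionAt (-L) q y ↔ ∃ q', RegularAt q' y ∧ q = q' * (l : RatFun Y) := by
  rw [hl.neg.sectionAt_iff, Units.val_inv_eq_inv_val]
  constructor
  · intro h
    exact ⟨_, h, by field_simp [l.ne_zero]⟩
  · rintro ⟨q', h, rfl⟩
    rwa [mul_assoc, mul_inv_cancel₀ l.ne_zero, mul_one]

variable {φ : X ⟶ Y} {ι : X ⟶ X} [IsDominant φ] [IsDominant ι]

/-- The given splitting need not be compatible with $\iota$ or contain $1$. The function $w$ is the
determinant of its basis $e_1,e_2$ and their conjugates, and the pair $1,w$ is then shown to be a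
basis of the same kind. -/
theorem exists_coverData [IsFinite φ] (hdeg : degree φ = 2) (hι : ι ≫ φ = φ) (hne : ι ≠ 𝟙 X)
    (h2 : ∀ y : Y, UnitAt (2 : RatFun Y) y) (L : Divisor Y)
    (hL : Nonempty ((Scheme.Modules.pushforward φ).obj (lineBundle (0 : Divisor X)) ≅
      lineBundle (0 : Divisor Y) ⊞ lineBundle (-L))) :
    ∃ w, CoverData φ ι L w := by
  obtain ⟨e₁, e₂, he⟩ := exists_isFrame hL.some
  have hψ : ∀ r, functionFieldMap ι (functionFieldMap φ r) = functionFieldMap φ r := fun r =>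
    (functionFieldMap_comp ι φ φ hι r).symm
  have hmove := exists_functionFieldMap_ne φ ι hι hne
  have hinv := map_map_eq (functionFieldMap φ) (functionFieldMap ι) hdeg hψ hmove
  have hfix : ∀ g, functionFieldMap ι g = g → ∃ r, g = functionFieldMap φ r := fun g hg =>
    exists_eq_of_map_eq (functionFieldMap φ) (functionFieldMap ι) hdeg hψ hmove hg
  have hreg : ∀ y g, (∀ x, φ x = y → RegularAt g x) ↔ ∃ p q, RegularAt p y ∧
      SectionAt (-L) q y ∧ g = functionFieldMap φ p * e₁ + functionFieldMap φ q * e₂ := by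
    intro y g
    have := he.sectionOver_iff y g
    simpa only [SectionOver, sectionAt_zero_iff] using this
  set s₁ := functionFieldMap ι e₁ with hs₁
  set s₂ := functionFieldMap ι e₂ with hs₂
  -- If this determinant vanished, $e_1/e_2$ would be invariant, so it would lie in $K(Y)$ and
  -- contradict independence.
  have hw0 : e₁ * s₂ - s₁ * e₂ ≠ 0 := by
    intro h
    have he₂ : e₂ ≠ 0 := by
      rintro rfl
      have := (he.indep 0 1 (by simp)).2
      exact one_ne_zero this
    have hs₂' : s₂ ≠ 0 := (map_ne_zero _).mpr he₂
    obtain ⟨r, hr⟩ := hfix (e₁ / e₂) (by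
      rw [map_div₀, div_eq_div_iff hs₂' he₂]
      linear_combination -h)
    have := (he.indep 1 (-r) (by
      rw [map_neg, map_one, ← hr]
      field_simp
      ring)).1
    exact one_ne_zero this
  refine ⟨e₁ * s₂ - s₁ * e₂, hι, hinv, hfix, ?_, hw0, h2, ?_⟩
  · rw [map_sub, map_mul, map_mul, hs₁, hs₂, hinv, hinv]
    ring
  intro y g
  set w := e₁ * s₂ - s₁ * e₂ with hw
  obtain ⟨l, hl⟩ := exists_isLocalEquation L y
  have hlw : ∀ x, φ x = y → RegularAt (functionFieldMap φ l * w) x := by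
    have h₁ := (hreg y e₁).mpr ⟨1, 0, regularAt_one y, .zero _ _, by simp⟩
    have h₂ := (hreg y (functionFieldMap φ l * e₂)).mpr
      ⟨0, l, regularAt_zero y, (hl.sectionAt_neg_iff _).mpr ⟨1, regularAt_one y, by simp⟩,
        by simp⟩
    intro x hx
    have hx' : φ (ι x) = y := by rw [apply_of_comp_eq hι, hx]
    have a₁ := (h₁ (ι x) hx').map ι
    have a₂ := (h₂ (ι x) hx').map ι
    rw [map_mul, hψ] at a₂
    have := ((h₁ x hx).mul a₂).sub (a₁.mul (h₂ x hx))
    convert this using 1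
    rw [hw]
    ring
  constructor
  · intro hg
    obtain ⟨α, β, hα, hβ, h1⟩ := (hreg y 1).mp fun x _ => regularAt_one x
    obtain ⟨γ, ε, hγ, hε, h3⟩ := (hreg y _).mp hlw
    obtain ⟨p, q, hp, hq, rfl⟩ := (hreg y g).mp hg
    obtain ⟨β, hβ', rfl⟩ := (hl.sectionAt_neg_iff _).mp hβ
    obtain ⟨ε, hε', rfl⟩ := (hl.sectionAt_neg_iff _).mp hε
    obtain ⟨q, hq', rfl⟩ := (hl.sectionAt_neg_iff _).mp hq
    have hwneg : functionFieldMap ι w = -w := by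
      rw [hw, map_sub, map_mul, map_mul, hs₁, hs₂, hinv, hinv]
      ring
    have h1' := congrArg (functionFieldMap ι) h1
    have h3' := congrArg (functionFieldMap ι) h3
    simp only [map_add, map_mul, map_one, hψ, hwneg, ← hs₁, ← hs₂] at h1 h1' h3 h3'
    have hψl : functionFieldMap φ (l : RatFun Y) ≠ 0 := (map_ne_zero _).mpr l.ne_zero
    -- Here $1=\alpha e_1+\beta le_2$ and $lw=\gamma e_1+\varepsilon le_2$. Their conjugate
    -- determinant is $-2lw$ on one side and $(\alpha\varepsilon-\beta\gamma)lw$ on the other. As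
    -- $2$ is a unit, the change of basis is invertible over the local ring.
    have hdet : functionFieldMap φ (α * ε - β * γ) = -2 := by
      have : functionFieldMap φ (l : RatFun Y) * w *
          (functionFieldMap φ (α * ε - β * γ) + 2) = 0 := by
        simp only [map_sub, map_mul]
        generalize functionFieldMap φ α = α at *
        generalize functionFieldMap φ β = β at *
        generalize functionFieldMap φ γ = γ at *
        generalize functionFieldMap φ ε = ε at *
        generalize functionFieldMap φ (l : RatFun Y) = l at *
        have key : (1 : RatFun X) * (l * -w) - 1 * (l * w) = (α * ε - β * γ) * l * w := by
          nth_rewrite 1 [h1]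
          rw [h3', h1', h3, hw]
          ring
        linear_combination -key
      rcases mul_eq_zero.mp this with h | h
      · exact (mul_ne_zero hψl hw0 h).elim
      · linear_combination h
    have h20 : (2 : RatFun Y) ≠ 0 := (h2 y).1
    have h20' : (2 : RatFun X) ≠ 0 := by
      have := (map_ne_zero (functionFieldMap φ)).mpr h20
      rwa [map_ofNat] at this
    have h1b : (1 : RatFun X) = functionFieldMap φ α * e₁ +
      functionFieldMap φ β * functionFieldMap φ l * e₂ := h1
    -- Cramer's rule with determinant $-2$.
    refine ⟨(q * γ - p * ε) * 2⁻¹, (p * β - q * α) * 2⁻¹ * l, ?_, ?_, ?_⟩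
    · exact ((hq'.mul hγ).sub (hp.mul hε')).mul (h2 y).2.2
    · exact (hl.sectionAt_neg_iff _).mpr
        ⟨_, ((hp.mul hβ').sub (hq'.mul hα)).mul (h2 y).2.2, rfl⟩
    · simp only [map_sub, map_mul, map_inv₀, map_ofNat] at hdet ⊢
      field_simp
      generalize functionFieldMap φ α = α at *
      generalize functionFieldMap φ β = β at *
      generalize functionFieldMap φ γ = γ at *
      generalize functionFieldMap φ ε = ε at *
      generalize functionFieldMap φ p = p at *
      generalize functionFieldMap φ q = q at *
      generalize functionFieldMap φ (l : RatFun Y) = l at *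
      linear_combination (p * e₁ + q * l * e₂) * hdet - (q * γ - p * ε) * h1b -
        (p * β - q * α) * h3
  · rintro ⟨p, q, hp, hq, rfl⟩ x rfl
    obtain ⟨q, hq', rfl⟩ := (hl.sectionAt_neg_iff _).mp hq
    rw [map_mul, mul_assoc]
    exact (hp.map φ).add ((hq'.map φ).mul (hlw x rfl))

end CoverData

/-! ### Vanishing at a point; reduced divisors are determined by their support. -/

section VanishAt

variable {X : Scheme.{u}} [IsIntegral X]

/-- A rational function vanishes at `x` if it lies in the maximal ideal of the local ring. -/
def VanishAt (g : RatFun X) (x : X) : Prop := RegularAt g x ∧ ¬ UnitAt g x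

lemma vanishAt_zero (x : X) : VanishAt (0 : RatFun X) x := ⟨regularAt_zero x, fun h => h.1 rfl⟩

lemma VanishAt.add {g h : RatFun X} {x : X} (hg : VanishAt g x) (hh : VanishAt h x) :
    VanishAt (g + h) x :=
  ⟨hg.1.add hh.1, fun H => (UnitAt.or_of_add hg.1 hh.1 H).elim hg.2 hh.2⟩

lemma VanishAt.mul_left {g h : RatFun X} {x : X} (hg : RegularAt g x) (hh : VanishAt h x) :
    VanishAt (g * h) x :=
  ⟨hg.mul hh.1, fun H => hh.2 (UnitAt.of_mul_left hh.1 hg (by rwa [mul_comm]))⟩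

lemma VanishAt.mul_right {g h : RatFun X} {x : X} (hg : VanishAt g x) (hh : RegularAt h x) :
    VanishAt (g * h) x := by
  rw [mul_comm]; exact .mul_left hh hg

lemma VanishAt.map {Y : Scheme.{u}} [IsIntegral Y] (φ : X ⟶ Y) [IsDominant φ] {g : RatFun Y}
    {x : X} (hg : VanishAt g (φ x)) : VanishAt (functionFieldMap φ g) x :=
  ⟨hg.1.map φ, fun h => hg.2 (h.of_map φ hg.1)⟩

lemma vanishAt_algebraMap_iff {x : X} (r : X.presheaf.stalk x) :
    VanishAt (algebraMap _ (RatFun X) r) x ↔ r ∈ IsLocalRing.maximalIdeal (X.presheaf.stalk x) := by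
  rw [IsLocalRing.mem_maximalIdeal, mem_nonunits_iff, ← unitAt_algebraMap_iff]
  exact ⟨fun h => h.2, fun h => ⟨⟨r, rfl⟩, h⟩⟩

end VanishAt

section ReducedDivisors

variable {X : Scheme.{u}} [IsIntegral X]

lemma regularAt_div_of_isRadical {D : Divisor X} (hr : HasReducedEquations D)
    (he : IsEffective D) {x : X} {u : (RatFun X)ˣ} (hu : IsLocalEquation D x u) {g : RatFun X}
    (hg : RegularAt g x) {n : ℕ} (h : RegularAt (g ^ n / (u : RatFun X)) x) :
    RegularAt (g / (u : RatFun X)) x := by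
  obtain ⟨d, hd⟩ := he x u hu
  obtain ⟨r, rfl⟩ := hg
  obtain ⟨c, hc⟩ := h
  have inj := IsFractionRing.injective (X.presheaf.stalk x) (RatFun X)
  have h1 : r ^ n ∈ Ideal.span {d} := by
    rw [Ideal.mem_span_singleton]
    refine ⟨c, inj ?_⟩
    rw [map_mul, hd, map_pow]
    refine Eq.trans ?_ (congrArg ((u : RatFun X) * ·) hc.symm)
    field_simp [u.ne_zero]
  obtain ⟨e, he⟩ := Ideal.mem_span_singleton.mp (hr x u d hu hd ⟨n, h1⟩)
  refine ⟨e, ?_⟩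
  rw [he, map_mul, hd]
  field_simp [u.ne_zero]

/-- The function `g` is divisible by the local equation of a reduced divisor `D` at `x` as soon
as it vanishes along the support of `D`. -/
lemma regularAt_div_of_vanishAt {D : Divisor X} (hr : HasReducedEquations D)
    (he : IsEffective D) {x : X} {u : (RatFun X)ˣ} (hu : IsLocalEquation D x u) {g : RatFun X}
    (hg : RegularAt g x) (h : ∀ y, y ⤳ x → y ∈ support D → ¬ UnitAt g y) :
    RegularAt (g / (u : RatFun X)) x := by
  obtain ⟨U, hU, hU'⟩ := hu.eventually
  -- Nullstellensatz: $u^{-1}$ is regular wherever `g` is a unit, so $g^n/u$ is regular for some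
  -- $n$. Reducedness then removes the exponent.
  obtain ⟨n, hn⟩ := exists_pow_mul_regularAt (h := (u : RatFun X)⁻¹) hg (by
    intro y hy hgy
    by_contra hreg
    refine h y hy ?_ hgy
    rw [(hU' y (hy.mem_open U.isOpen hU)).mem_support_iff]
    exact fun H => hreg H.2.2)
  exact regularAt_div_of_isRadical hr he hu hg (n := n) (by rwa [div_eq_mul_inv])

lemma eq_of_support_eq {D E : Divisor X} (hD : HasReducedEquations D) (hD' : IsEffective D)
    (hE : HasReducedEquations E) (hE' : IsEffective E) (h : support D = support E) : D = E := by
  refine Divisor.ext_of_isLocalEquation fun x => ?_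
  obtain ⟨u, hu⟩ := exists_isLocalEquation D x
  obtain ⟨v, hv⟩ := exists_isLocalEquation E x
  refine ⟨u, hu, hv.iff_unitAt.mpr ⟨div_ne_zero u.ne_zero v.ne_zero, ?_, ?_⟩⟩
  · refine regularAt_div_of_vanishAt hE hE' hv (hD' x u hu) fun y hy hyE => ?_
    obtain ⟨U, hU, hU'⟩ := hu.eventually
    exact (hU' y (hy.mem_open U.isOpen hU)).mem_support_iff.mp (h ▸ hyE)
  · rw [inv_div]
    refine regularAt_div_of_vanishAt hD hD' hu (hE' x v hv) fun y hy hyD => ?_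
    obtain ⟨U, hU, hU'⟩ := hv.eventually
    exact (hU' y (hy.mem_open U.isOpen hU)).mem_support_iff.mp (h ▸ hyD)

end ReducedDivisors

lemma IsLocalEquation.zeroDivisor_two_nsmul {Y : Scheme.{u}} [IsIntegral Y] {L : Divisor Y} {y : Y}
    {l : (RatFun Y)ˣ} (hl : IsLocalEquation L y l) (W : (RatFun Y)ˣ) :
    IsLocalEquation (zeroDivisor ((2 : ℕ) • L) W) y (l * l * W) :=
  hl.two_nsmul.add (isLocalEquation_principal W y)

lemma map_sq_mul {X Y : Scheme.{u}} [IsIntegral X] [IsIntegral Y] {φ : X ⟶ Y} [IsDominant φ]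
    {w : RatFun X} {W : (RatFun Y)ˣ} (hW : functionFieldMap φ W = w * w) (l : RatFun Y) :
    functionFieldMap φ (l * l * (W : RatFun Y)) =
      functionFieldMap φ l * w * (functionFieldMap φ l * w) := by
  rw [map_mul, map_mul, hW]; ring

/-! ### The divisor of $W=w^2$ is the branch divisor. -/

namespace CoverData

variable {X Y : Scheme.{u}} [IsIntegral X] [IsIntegral Y]
  {φ : X ⟶ Y} {ι : X ⟶ X} [IsDominant φ] [IsDominant ι] {L : Divisor Y} {w : RatFun X}
  (C : CoverData φ ι L w)
include C

lemma map_pull (r : RatFun Y) :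
    functionFieldMap ι (functionFieldMap φ r) = functionFieldMap φ r :=
  (functionFieldMap_comp ι φ φ C.comp r).symm

lemma two_ne_zero : (2 : RatFun Y) ≠ 0 := (C.unitAt_two (genericPoint Y)).1

lemma two_ne_zero' : (2 : RatFun X) ≠ 0 := by
  have := (map_ne_zero (functionFieldMap φ)).mpr C.two_ne_zero
  rwa [map_ofNat] at this

lemma exists_eq_add (g : RatFun X) :
    ∃ p q, g = functionFieldMap φ p + functionFieldMap φ q * w := by
  have h2 := C.two_ne_zero'
  have hw := C.w_ne_zero
  obtain ⟨p, hp⟩ := C.fixed ((g + functionFieldMap ι g) / 2) (by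
    rw [map_div₀, map_add, C.map_map, map_ofNat, add_comm])
  obtain ⟨q, hq⟩ := C.fixed ((g - functionFieldMap ι g) / (2 * w)) (by
    rw [map_div₀, map_sub, C.map_map, map_mul, map_ofNat, C.map_w, mul_neg, div_neg,
      ← neg_div, neg_sub])
  refine ⟨p, q, ?_⟩
  rw [← hp, ← hq]
  field_simp
  ring

lemma eq_zero_of_add_eq_zero {p q : RatFun Y}
    (h : functionFieldMap φ p + functionFieldMap φ q * w = 0) : p = 0 ∧ q = 0 := by
  have h' := congrArg (functionFieldMap ι) h
  rw [map_add, map_mul, C.map_pull, C.map_pull, C.map_w, map_zero] at h'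
  have hp : 2 * functionFieldMap φ p = 0 := by linear_combination h + h'
  have hq : 2 * w * functionFieldMap φ q = 0 := by linear_combination h - h'
  have h2 := C.two_ne_zero'
  have hw := C.w_ne_zero
  simpa [h2, hw] using And.intro hp hq

lemma eq_and_eq {p q p' q' : RatFun Y}
    (h : functionFieldMap φ p + functionFieldMap φ q * w =
      functionFieldMap φ p' + functionFieldMap φ q' * w) : p = p' ∧ q = q' := by
  have := C.eq_zero_of_add_eq_zero (p := p - p') (q := q - q') (by
    rw [map_sub, map_sub]; linear_combination h)
  exact ⟨sub_eq_zero.mp this.1, sub_eq_zero.mp this.2⟩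

lemma exists_sq : ∃ W : (RatFun Y)ˣ, functionFieldMap φ W = w * w := by
  obtain ⟨W, hW⟩ := C.fixed (w * w) (by rw [map_mul, C.map_w]; ring)
  have h0 : W ≠ 0 := by
    rintro rfl
    rw [map_zero] at hW
    exact mul_ne_zero C.w_ne_zero C.w_ne_zero hW
  exact ⟨Units.mk0 W h0, hW.symm⟩

lemma regular_iff' {y : Y} {l : (RatFun Y)ˣ} (hl : IsLocalEquation L y l) (g : RatFun X) :
    (∀ x, φ x = y → RegularAt g x) ↔ ∃ p q, RegularAt p y ∧ RegularAt q y ∧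
      g = functionFieldMap φ p + functionFieldMap φ (q * (l : RatFun Y)) * w := by
  rw [C.regular_iff]
  constructor
  · rintro ⟨p, q, hp, hq, rfl⟩
    obtain ⟨q, hq', rfl⟩ := (hl.sectionAt_neg_iff _).mp hq
    exact ⟨p, q, hp, hq', rfl⟩
  · rintro ⟨p, q, hp, hq, rfl⟩
    exact ⟨p, _, hp, (hl.sectionAt_neg_iff _).mpr ⟨q, hq, rfl⟩, rfl⟩

/-- Coordinates with respect to $1,w$ are unique, so regularity along a whole fibre of $X$ descends
to the coefficients on $Y$. -/
lemma regularAt_coeffs {y : Y} {l : (RatFun Y)ˣ} (hl : IsLocalEquation L y l) {p q : RatFun Y}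
    (h : ∀ x, φ x = y →
      RegularAt (functionFieldMap φ p + functionFieldMap φ (q * (l : RatFun Y)) * w) x) :
    RegularAt p y ∧ RegularAt q y := by
  obtain ⟨p', q', hp, hq, he⟩ := (C.regular_iff' hl _).mp h
  obtain ⟨rfl, h2⟩ := C.eq_and_eq he
  rw [mul_right_cancel₀ l.ne_zero h2]
  exact ⟨hp, hq⟩

lemma regularAt_of_map {y : Y} {p : RatFun Y}
    (h : ∀ x, φ x = y → RegularAt (functionFieldMap φ p) x) : RegularAt p y := by
  obtain ⟨l, hl⟩ := exists_isLocalEquation L y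
  exact (C.regularAt_coeffs hl (p := p) (q := 0) (by simpa using h)).1

lemma regular_l_mul_w {y : Y} {l : (RatFun Y)ˣ} (hl : IsLocalEquation L y l) (x : X)
    (hx : φ x = y) : RegularAt (functionFieldMap φ l * w) x :=
  (C.regular_iff' hl _).mpr ⟨0, 1, regularAt_zero y, regularAt_one y, by simp⟩ x hx

variable {W : (RatFun Y)ˣ} (hW : functionFieldMap φ W = w * w)
include hW

lemma regularAt_sq {y : Y} {l : (RatFun Y)ˣ} (hl : IsLocalEquation L y l) :
    RegularAt ((l : RatFun Y) * (l : RatFun Y) * (W : RatFun Y)) y :=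
  C.regularAt_of_map fun x hx => by
    rw [map_sq_mul hW]
    exact (C.regular_l_mul_w hl x hx).mul (C.regular_l_mul_w hl x hx)

lemma isEffective_zeroDivisor : IsEffective (zeroDivisor ((2 : ℕ) • L) W) := by
  intro y u hu
  obtain ⟨l, hl⟩ := exists_isLocalEquation L y
  have h := (hl.zeroDivisor_two_nsmul W).unitAt_div hu
  have := h.2.1.mul (C.regularAt_sq hW hl)
  rwa [Units.val_mul, Units.val_mul, div_mul_cancel₀] at this
  exact mul_ne_zero (mul_ne_zero l.ne_zero l.ne_zero) W.ne_zero

/-- If $c^2=ue$ with $u$ an equation of the divisor, then $(c/u)^2z^2=(l^2W/u)e$ is regular. By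
`hsq` the function $(c/u)z$ is regular on $X$, so its coefficient $c/u$ is regular on $Y$. -/
lemma hasReducedEquations_zeroDivisor
    (hsq : ∀ (x : X) (h : RatFun X), RegularAt (h ^ 2) x → RegularAt h x) :
    HasReducedEquations (zeroDivisor ((2 : ℕ) • L) W) := by
  intro y u d hu hd
  rw [← isRadical_iff_span_singleton, isRadical_iff_pow_one_lt 2 one_lt_two]
  rintro c ⟨e, he⟩
  obtain ⟨l, hl⟩ := exists_isLocalEquation L y
  have inj := IsFractionRing.injective (Y.presheaf.stalk y) (RatFun Y)
  set c' := algebraMap (Y.presheaf.stalk y) (RatFun Y) c with hc'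
  set e' := algebraMap (Y.presheaf.stalk y) (RatFun Y) e with he'
  have hce : c' ^ 2 = u * e' := by rw [hc', he', ← map_pow, he, map_mul, hd]
  have hu0 := u.ne_zero
  have hu1 := (hu.unitAt_div (hl.zeroDivisor_two_nsmul W)).2.1
  rw [Units.val_mul, Units.val_mul] at hu1
  have key : ∀ x, φ x = y → RegularAt (functionFieldMap φ 0 +
      functionFieldMap φ (c' / u * (l : RatFun Y)) * w) x := by
    rintro x rfl
    apply hsq
    have : (functionFieldMap φ 0 + functionFieldMap φ (c' / u * (l : RatFun Y)) * w) ^ 2 =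
        functionFieldMap φ ((l : RatFun Y) * l * W / u * e') := by
      rw [map_zero, zero_add, mul_pow, ← map_pow, sq w, ← hW, ← map_mul]
      congr 1
      rw [mul_pow, div_pow, hce]
      field_simp
    rw [this]
    exact (hu1.mul ⟨e, rfl⟩).map φ
  obtain ⟨r, hr⟩ := (C.regularAt_coeffs hl key).2
  refine ⟨r, inj ?_⟩
  rw [map_mul, hd]
  refine Eq.trans ?_ (congrArg ((u : RatFun Y) * ·) hr.symm)
  rw [← hc']
  field_simp

end CoverData

lemma UnitAt.eventually {X : Scheme.{u}} [IsIntegral X] {g : RatFun X} {x : X} (hg : UnitAt g x) :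
    ∃ U : X.Opens, x ∈ U ∧ ∀ y ∈ U, UnitAt g y := by
  obtain ⟨U, hU, hU'⟩ := hg.2.1.eventually
  obtain ⟨V, hV, hV'⟩ := hg.2.2.eventually
  exact ⟨U ⊓ V, ⟨hU, hV⟩, fun y hy => ⟨hg.1, hU' y hy.1, hV' y hy.2⟩⟩

lemma exists_isUnit_toRat_eq {X : Scheme.{u}} [IsIntegral X] {U : X.Opens} {x : X} (hx : x ∈ U)
    {g : RatFun X} (hg : ∀ y ∈ U, UnitAt g y) : ∃ r : Γ(X, U), IsUnit r ∧ toRat hx r = g := by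
  obtain ⟨r, hr⟩ := exists_section_of_regularAt hx fun y hy => (hg y hy).2.1
  obtain ⟨s, hs⟩ := exists_section_of_regularAt hx fun y hy => (hg y hy).2.2
  refine ⟨r, IsUnit.of_mul_eq_one s (toRat_injective hx ?_), hr⟩
  rw [map_mul, hr, hs, map_one, mul_inv_cancel₀ (hg x hx).1]

namespace CoverData

variable {X Y : Scheme.{u}} [IsIntegral X] [IsIntegral Y]
  {φ : X ⟶ Y} {ι : X ⟶ X} [IsDominant φ] [IsDominant ι] {L : Divisor Y} {w : RatFun X}
  (C : CoverData φ ι L w) {W : (RatFun Y)ˣ} (hW : functionFieldMap φ W = w * w)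
include C hW

/-- Over a small affine $V$ the coordinate ring of $\varphi^{-1}V$ is free on $1,z$ with $z^2=b$ a
unit, so `etale_of_sq_eq` applies. -/
lemma exists_etale_of_unitAt [IsFinite φ] {x : X} {l : (RatFun Y)ˣ}
    (hl : IsLocalEquation L (φ x) l)
    (hb : UnitAt ((l : RatFun Y) * (l : RatFun Y) * (W : RatFun Y)) (φ x)) :
    ∃ U : X.Opens, x ∈ U ∧ Etale (U.ι ≫ φ) := by
  obtain ⟨V₁, hV₁, hV₁'⟩ := hl.eventually
  obtain ⟨V₂, hV₂, hV₂'⟩ := hb.eventually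
  obtain ⟨_, ⟨V, hV, rfl⟩, hy, hVle⟩ := Y.isBasis_affineOpens.exists_subset_of_mem_open
    (show φ x ∈ ((V₁ ⊓ V₂ : Y.Opens) : Set Y) from ⟨hV₁, hV₂⟩) (V₁ ⊓ V₂).isOpen
  replace hV : IsAffineOpen V := hV
  replace hy : φ x ∈ V := hy
  have hx : x ∈ φ ⁻¹ᵁ V := hy
  obtain ⟨b, hbu, hb'⟩ := exists_isUnit_toRat_eq hy fun y hy' => hV₂' y (hVle hy').2
  obtain ⟨t, htu, ht⟩ := exists_isUnit_toRat_eq hy fun y _ => C.unitAt_two y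
  obtain ⟨z, hz⟩ := exists_section_of_regularAt hx
    (fun x' hx' => C.regular_l_mul_w (hV₁' _ (hVle hx').1) x' rfl)
  refine ⟨φ ⁻¹ᵁ V, hx, etale_of_app φ hV (hV.preimage φ) ?_⟩
  have hψ : ∀ r : Γ(Y, V), toRat hx (φ.app V r) = functionFieldMap φ (toRat hy r) := fun r =>
    (functionFieldMap_toRat φ hy hx r).symm
  let _ := (φ.app V).hom.toAlgebra
  change Algebra.Etale Γ(Y, V) Γ(X, φ ⁻¹ᵁ V)
  have hlw : ∀ p q : Γ(Y, V), toRat hx (φ.app V p + φ.app V q * z) =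
      functionFieldMap φ (toRat hy p) + functionFieldMap φ (toRat hy q * (l : RatFun Y)) * w := by
    intro p q
    rw [map_add, map_mul, hψ, hψ, hz, map_mul, mul_assoc]
  refine etale_of_sq_eq z b (toRat_injective hx ?_) hbu ?_ (fun a => ?_) fun p q hpq => ?_
  · change _ = toRat hx (φ.app V b)
    rw [hψ, hb', map_sq_mul hW, map_mul, hz]
  · have : t = 2 := toRat_injective hy (by rw [ht, map_ofNat])
    exact this ▸ htu
  · obtain ⟨p, q, hpq⟩ := C.exists_eq_add (toRat hx a)
    have hpq' : toRat hx a = functionFieldMap φ p +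
        functionFieldMap φ (q / (l : RatFun Y) * (l : RatFun Y)) * w := by
      rwa [div_mul_cancel₀ _ l.ne_zero]
    have hreg : ∀ y ∈ V, RegularAt p y ∧ RegularAt (q / (l : RatFun Y)) y := fun y hy' =>
      C.regularAt_coeffs (hV₁' y (hVle hy').1) fun x' hx' => by
        rw [← hpq']
        exact regularAt_toRat hx (by change φ x' ∈ V; rwa [hx']) a
    obtain ⟨p', hp'⟩ := exists_section_of_regularAt hy fun y hy' => (hreg y hy').1
    obtain ⟨q', hq'⟩ := exists_section_of_regularAt hy fun y hy' => (hreg y hy').2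
    refine ⟨p', q', toRat_injective hx ?_⟩
    change _ = toRat hx (φ.app V p' + φ.app V q' * z)
    rw [hlw, hp', hq', hpq']
  · have h := congrArg (toRat hx) hpq
    change toRat hx (φ.app V p + φ.app V q * z) = _ at h
    rw [hlw, map_zero] at h
    obtain ⟨h₁, h₂⟩ := C.eq_zero_of_add_eq_zero h
    refine ⟨toRat_injective hy (by rw [h₁, map_zero]), toRat_injective hy ?_⟩
    rw [map_zero]
    exact (mul_eq_zero.mp h₂).resolve_right l.ne_zero

lemma vanishAt_l_mul_w {x : X} {l : (RatFun Y)ˣ} (hl : IsLocalEquation L (φ x) l)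
    (hb : VanishAt ((l : RatFun Y) * (l : RatFun Y) * (W : RatFun Y)) (φ x)) :
    VanishAt (functionFieldMap φ l * w) x := by
  refine ⟨C.regular_l_mul_w hl x rfl, fun h => (hb.map φ).2 ?_⟩
  rw [map_sq_mul hW]
  exact h.mul h

/-- Over a branch point, the local ring of `X` is `𝒪_Y ⊕ 𝒪_Y z`. -/
lemma exists_eq_add_of_vanishAt [IsFinite φ] {x : X} {l : (RatFun Y)ˣ}
    (hl : IsLocalEquation L (φ x) l)
    (hb : VanishAt ((l : RatFun Y) * (l : RatFun Y) * (W : RatFun Y)) (φ x)) {g : RatFun X}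
    (hg : RegularAt g x) : ∃ p q, RegularAt p (φ x) ∧ RegularAt q (φ x) ∧
      g = functionFieldMap φ p + functionFieldMap φ (q * (l : RatFun Y)) * w := by
  obtain ⟨_, ⟨V, hV, rfl⟩, hy, -⟩ :=
    Y.isBasis_affineOpens.exists_subset_of_mem_open (Set.mem_univ (φ x)) isOpen_univ
  replace hV : IsAffineOpen V := hV
  have hx : x ∈ φ ⁻¹ᵁ V := hy
  have hz := C.vanishAt_l_mul_w hW hl hb
  have hsec : ∀ a : Γ(X, φ ⁻¹ᵁ V), ∃ p q, RegularAt p (φ x) ∧ RegularAt q (φ x) ∧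
      toRat hx a = functionFieldMap φ p + functionFieldMap φ (q * (l : RatFun Y)) * w :=
    fun a => (C.regular_iff' hl _).mp fun x' hx' =>
      regularAt_toRat hx (show φ x' ∈ V from hx' ▸ hy) a
  obtain ⟨a, s, hs, rfl⟩ := hg.exists_div (hV.preimage φ) hx hx
  obtain ⟨p₁, q₁, hp₁, hq₁, ha⟩ := hsec a
  obtain ⟨p₂, q₂, hp₂, hq₂, hs'⟩ := hsec s
  set b : RatFun Y := (l : RatFun Y) * (l : RatFun Y) * (W : RatFun Y) with hbdef
  have hψb := map_sq_mul hW (l : RatFun Y)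
  rw [← hbdef] at hψb
  -- The denominator $s=p_2+q_2z$ is a unit and $z$ vanishes at `x`, so $p_2$ is a unit. Hence so is
  -- the norm $p_2^2-q_2^2b$, and multiplying by the conjugate of $s$ rationalises the fraction.
  have hp₂u : UnitAt p₂ (φ x) := by
    refine .of_map φ hp₂ ?_
    rw [hs', map_mul, mul_assoc] at hs
    exact (UnitAt.or_of_add (hp₂.map φ) ((hq₂.map φ).mul hz.1) hs).resolve_right
      (VanishAt.mul_left (hq₂.map φ) hz).2
  have hN : UnitAt (p₂ * p₂ - q₂ * q₂ * b) (φ x) := by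
    by_contra hN
    refine (VanishAt.add ⟨(hp₂.mul hp₂).sub ((hq₂.mul hq₂).mul hb.1), hN⟩
      (VanishAt.mul_left (hq₂.mul hq₂) hb)).2 ?_
    rw [sub_add_cancel]
    exact hp₂u.mul hp₂u
  refine ⟨(p₁ * p₂ - q₁ * q₂ * b) * (p₂ * p₂ - q₂ * q₂ * b)⁻¹,
    (q₁ * p₂ - p₁ * q₂) * (p₂ * p₂ - q₂ * q₂ * b)⁻¹,
    ((hp₁.mul hp₂).sub ((hq₁.mul hq₂).mul hb.1)).mul hN.2.2,
    ((hq₁.mul hp₂).sub (hp₁.mul hq₂)).mul hN.2.2, ?_⟩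
  have hN0 := (map_ne_zero (functionFieldMap φ)).mpr hN.1
  rw [ha, hs', div_eq_iff (hs' ▸ hs.1)]
  have hn := mul_inv_cancel₀ hN0
  simp only [map_mul, map_sub, map_inv₀] at hn hψb ⊢
  set P₁ := functionFieldMap φ p₁
  set P₂ := functionFieldMap φ p₂
  set Q₁ := functionFieldMap φ q₁
  set Q₂ := functionFieldMap φ q₂
  set l' := functionFieldMap φ (l : RatFun Y)
  set n := (P₂ * P₂ - Q₂ * Q₂ * functionFieldMap φ b)⁻¹
  linear_combination -(P₁ + Q₁ * (l' * w)) * hn + n * (Q₁ * P₂ * Q₂ - P₁ * Q₂ ^ 2) * hψb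

lemma not_etale_of_vanishAt [IsFinite φ] {x : X} {l : (RatFun Y)ˣ}
    (hl : IsLocalEquation L (φ x) l)
    (hb : VanishAt ((l : RatFun Y) * (l : RatFun Y) * (W : RatFun Y)) (φ x))
    (U : X.Opens) (hx : x ∈ U) : ¬ Etale (U.ι ≫ φ) := by
  intro het
  have hm := maximalIdeal_eq_map_of_etale φ U hx het
  have hz := C.vanishAt_l_mul_w hW hl hb
  -- Elements of $\mathfrak m_Y\mathcal O_X$ have both coordinates in $\mathfrak m_Y$. But
  -- $z\in\mathfrak m_X$ has coordinates $0$ and $1$, so $\mathfrak m_Y\mathcal O_X\ne\mathfrak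
  -- m_X$.
  have key : ∀ r ∈ (IsLocalRing.maximalIdeal (Y.presheaf.stalk (φ x))).map (φ.stalkMap x).hom,
      ∃ p q, VanishAt p (φ x) ∧ VanishAt q (φ x) ∧ algebraMap (X.presheaf.stalk x) (RatFun X) r =
        functionFieldMap φ p + functionFieldMap φ (q * (l : RatFun Y)) * w := by
    intro r hr
    refine Submodule.span_induction ?_ ?_ ?_ ?_ hr
    · rintro _ ⟨t, ht, rfl⟩
      refine ⟨algebraMap _ _ t, 0, (vanishAt_algebraMap_iff t).mpr ht, vanishAt_zero _, ?_⟩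
      rw [zero_mul, map_zero, zero_mul, add_zero]
      exact (functionFieldMap_algebraMap φ x t).symm
    · exact ⟨0, 0, vanishAt_zero _, vanishAt_zero _, by simp⟩
    · rintro a b - - ⟨p, q, hp, hq, ha⟩ ⟨p', q', hp', hq', hb⟩
      refine ⟨p + p', q + q', hp.add hp', hq.add hq', ?_⟩
      rw [map_add, ha, hb]
      simp only [map_add, map_mul]
      ring
    · rintro a b - ⟨p, q, hp, hq, hb'⟩
      obtain ⟨p', q', hp', hq', ha⟩ := C.exists_eq_add_of_vanishAt hW hl hb
        (g := algebraMap _ _ a) ⟨a, rfl⟩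
      refine ⟨p' * p + q' * q * ((l : RatFun Y) * (l : RatFun Y) * (W : RatFun Y)),
        p' * q + q' * p, (VanishAt.mul_left hp' hp).add ((VanishAt.mul_left hq' hq).mul_right hb.1),
        (VanishAt.mul_left hp' hq).add (VanishAt.mul_left hq' hp), ?_⟩
      rw [smul_eq_mul, map_mul, ha, hb', map_add, map_mul _ (q' * q), map_sq_mul hW]
      simp only [map_add, map_mul]
      ring
  obtain ⟨r, hr⟩ := hz.1
  have hrm : r ∈ IsLocalRing.maximalIdeal (X.presheaf.stalk x) := by
    rw [← vanishAt_algebraMap_iff, hr]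
    exact hz
  obtain ⟨p, q, -, hq, h⟩ := key r (hm ▸ hrm)
  have := (C.eq_and_eq (p := 0) (q := l) (by rw [← h, hr]; simp)).2
  have hq1 : q = 1 := (mul_eq_right₀ l.ne_zero).mp this.symm
  exact hq.2 (hq1 ▸ unitAt_one _)

lemma support_zeroDivisor [IsFinite φ] [Surjective φ] :
    support (zeroDivisor ((2 : ℕ) • L) W) = φ '' ramificationLocus φ := by
  ext y
  obtain ⟨l, hl⟩ := exists_isLocalEquation L y
  rw [(hl.zeroDivisor_two_nsmul W).mem_support_iff, Units.val_mul, Units.val_mul]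
  constructor
  · intro h
    obtain ⟨x, rfl⟩ := φ.surjective y
    exact ⟨x, fun ⟨U, hU, het⟩ =>
      C.not_etale_of_vanishAt hW hl ⟨C.regularAt_sq hW hl, h⟩ U hU het, rfl⟩
  · rintro ⟨x, hx, rfl⟩ h
    exact hx (C.exists_etale_of_unitAt hW hl h)

theorem zeroDivisor_eq [IsFinite φ] [Surjective φ]
    (hsq : ∀ (x : X) (h : RatFun X), RegularAt (h ^ 2) x → RegularAt h x) {B : Divisor Y}
    (hB : IsBranchDivisor φ B) : zeroDivisor ((2 : ℕ) • L) W = B :=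
  eq_of_support_eq (C.hasReducedEquations_zeroDivisor hW hsq) (C.isEffective_zeroDivisor hW)
    hB.2.1 hB.1 ((C.support_zeroDivisor hW).trans hB.2.2.symm)

end CoverData

/-! ### Global functions are constants. -/

section Constants

variable {Y : Scheme.{u}} [IsIntegral Y] {k : Type u} [Field k]
  (s : Y ⟶ Spec (CommRingCat.of k))

/-- The constant functions on a scheme over a field. -/
noncomputable def constants : k →+* RatFun Y :=
  (toRat (U := ⊤) (x := genericPoint Y) trivial).comp
    (s.appTop.hom.comp (Scheme.ΓSpecIso (CommRingCat.of k)).inv.hom)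

lemma unitAt_constants {c : k} (hc : c ≠ 0) (y : Y) : UnitAt (constants s c) y :=
  ⟨(map_ne_zero _).mpr hc, regularAt_toRat (U := ⊤) trivial trivial _, by
    rw [← map_inv₀]; exact regularAt_toRat (U := ⊤) trivial trivial _⟩

lemma exists_constants_eq (hs : IsIso s.appTop) {q : RatFun Y} (hq : ∀ y, RegularAt q y) :
    ∃ c, constants s c = q := by
  obtain ⟨r, rfl⟩ := exists_section_of_regularAt (U := ⊤) (x := genericPoint Y) trivial
    fun y _ => hq y
  have := hs
  let e := (Scheme.ΓSpecIso (CommRingCat.of k)).symm ≪≫ asIso s.appTop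
  refine ⟨e.inv.hom r, ?_⟩
  change toRat _ ((e.inv ≫ e.hom).hom r) = _
  rw [e.inv_hom_id]
  rfl

include s in
lemma unitAt_two [CharZero k] (y : Y) : UnitAt (2 : RatFun Y) y := by
  have := unitAt_constants s (two_ne_zero (α := k)) y
  rwa [map_ofNat] at this

end Constants

lemma IsLocalEquation.specializes {X : Scheme.{u}} [IsIntegral X] {D : Divisor X} {x y : X}
    {u : (RatFun X)ˣ} (hu : IsLocalEquation D x u) (h : y ⤳ x) : IsLocalEquation D y u := by
  obtain ⟨U, hU, hU'⟩ := hu.eventually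
  exact hU' y (h.mem_open U.isOpen hU)

/-! ### Sections over a fibre that generate at a chosen point. -/

section Generators

variable {X Y : Scheme.{u}} [IsIntegral X] (φ : X ⟶ Y) [IsFinite φ]

/-- Over a neighbourhood of a point of the target of a finite morphism, a divisor has a section
generating its line bundle at a given point of the source. -/
lemma exists_sectionOver_unitAt (E : Divisor X) {x : X} {u : (RatFun X)ˣ}
    (hu : IsLocalEquation E x u) :
    ∃ g, SectionOver φ E g (φ x) ∧ UnitAt (g * (u : RatFun X)) x := by
  obtain ⟨_, ⟨V, hV, rfl⟩, hy, -⟩ :=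
    Y.isBasis_affineOpens.exists_subset_of_mem_open (Set.mem_univ (φ x)) isOpen_univ
  replace hV : IsAffineOpen V := hV
  have hx : x ∈ φ ⁻¹ᵁ V := hy
  obtain ⟨U, hU, hU'⟩ := hu.eventually
  -- The function $1/u$ generates near `x` but may have poles at other points of the fibre. A power
  -- of `s`, a unit at `x` whose unit locus lies where `u` is an equation, clears them. The fibre is
  -- finite, so one exponent `N` serves all its points.
  obtain ⟨s, hs, hs'⟩ := exists_toRat_unitAt (hV.preimage φ) hx hU
  have hmem : ∀ x', φ x' = φ x → x' ∈ φ ⁻¹ᵁ V := fun x' h => by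
    change φ x' ∈ V
    rw [h]
    exact hy
  have key : ∀ x', φ x' = φ x → ∃ n : ℕ, SectionAt E (toRat hx s ^ n / (u : RatFun X)) x' := by
    intro x' h
    obtain ⟨v, hv⟩ := exists_isLocalEquation E x'
    obtain ⟨n, hn⟩ := exists_pow_mul_regularAt (h := (v : RatFun X) / (u : RatFun X))
      (regularAt_toRat hx (hmem x' h) s) fun y hyx hyu =>
        ((hU' y (hs' y (hyx.mem_open (φ ⁻¹ᵁ V).isOpen (hmem x' h)) hyu)).unitAt_div
          (hv.specializes hyx)).2.1
    refine ⟨n, (hv.sectionAt_iff _).mpr ?_⟩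
    rwa [div_mul_eq_mul_div, mul_div_assoc]
  choose! n hn using key
  have hfin : {x' | φ x' = φ x}.Finite := φ.finite_preimage_singleton (φ x)
  set N := hfin.toFinset.sup n with hN
  refine ⟨toRat hx s ^ N / (u : RatFun X), fun x' h => ?_, ?_⟩
  · obtain ⟨v, hv⟩ := exists_isLocalEquation E x'
    have hle : n x' ≤ N := Finset.le_sup (hfin.mem_toFinset.mpr h)
    have h1 := (hv.sectionAt_iff _).mp (hn x' h)
    rw [hv.sectionAt_iff, ← Nat.sub_add_cancel hle, pow_add, mul_div_assoc, mul_assoc]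
    exact ((regularAt_toRat hx (hmem x' h) s).pow _).mul h1
  · rw [div_mul_cancel₀ _ u.ne_zero]
    exact hs.pow N

end Generators

/-! ### Determinants of sections of $\varphi_*\mathcal O_X(E)$. -/

namespace CoverData

variable {X Y : Scheme.{u}} [IsIntegral X] [IsIntegral Y]
  {φ : X ⟶ Y} {ι : X ⟶ X} [IsDominant φ] [IsDominant ι] {L : Divisor Y} {w : RatFun X}
  (C : CoverData φ ι L w)

section
include C

lemma exists_eq_mul_w {g : RatFun X} (hg : functionFieldMap ι g = -g) :
    ∃ q, g = functionFieldMap φ q * w := by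
  obtain ⟨q, hq⟩ := C.fixed (g / w) (by rw [map_div₀, hg, C.map_w, neg_div_neg_eq])
  exact ⟨q, by rw [← hq, div_mul_cancel₀ _ C.w_ne_zero]⟩

end

/-- An equation of $\iota^*E$ at $x$ is the pullback of an equation of $E$ at $\iota x$, so both
quantities are equations of $\varphi^*D$ at $x$. -/
lemma unitAt_norm {E : Divisor X} {D : Divisor Y}
    (hD : pullbackDivisor φ D = E + pullbackDivisor ι E) {x : X} {d : (RatFun Y)ˣ}
    {u v : (RatFun X)ˣ} (hd : IsLocalEquation D (φ x) d) (hu : IsLocalEquation E x u)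
    (hv : IsLocalEquation E (ι x) v) :
    UnitAt (functionFieldMap φ d / ((u : RatFun X) * functionFieldMap ι v)) x := by
  have h1 := hd.pullback φ
  rw [hD] at h1
  exact (hu.add (hv.pullback ι)).unitAt_div h1

section
include C

variable {E : Divisor X} {D : Divisor Y} (hD : pullbackDivisor φ D = E + pullbackDivisor ι E)
include hD

lemma regularAt_mul_map {y : Y} {d : (RatFun Y)ˣ} (hd : IsLocalEquation D y d) {g h : RatFun X}
    (hg : SectionOver φ E g y) (hh : SectionOver φ E h y) (x : X) (hx : φ x = y) :
    RegularAt (g * functionFieldMap ι h * functionFieldMap φ d) x := by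
  subst hx
  obtain ⟨u, hu⟩ := exists_isLocalEquation E x
  obtain ⟨v, hv⟩ := exists_isLocalEquation E (ι x)
  have h1 := (hu.sectionAt_iff g).mp (hg x rfl)
  have h2 := ((hv.sectionAt_iff h).mp (hh (ι x) (apply_of_comp_eq C.comp x))).map ι
  have h3 := (h1.mul h2).mul (unitAt_norm hD hd hu hv).2.1
  have hv0 := (map_ne_zero (functionFieldMap ι)).mpr v.ne_zero
  have hu0 := u.ne_zero
  rw [map_mul] at h3
  convert h3 using 1
  field_simp

/-- The poles of $g\bar h$ lie on $E+\iota^*E$ and are cancelled by $d$, so $g\bar hd=p+qz$ with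
regular coefficients. Subtracting the conjugate leaves $2qz$. -/
lemma exists_coeffs_mul_map {y : Y} {d l : (RatFun Y)ˣ} (hd : IsLocalEquation D y d)
    (hl : IsLocalEquation L y l) {g h : RatFun X}
    (hg : SectionOver φ E g y) (hh : SectionOver φ E h y) :
    ∃ p q, RegularAt p y ∧ RegularAt q y ∧
      g * functionFieldMap ι h * functionFieldMap φ d =
        functionFieldMap φ p + functionFieldMap φ (q * (l : RatFun Y)) * w ∧
      (g * functionFieldMap ι h - functionFieldMap ι g * h) * functionFieldMap φ d =
        functionFieldMap φ (2 * q * (l : RatFun Y)) * w := by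
  obtain ⟨p, q, hp, hq, h1⟩ := (C.regular_iff' hl _).mp (C.regularAt_mul_map hD hd hg hh)
  refine ⟨p, q, hp, hq, h1, ?_⟩
  have h2 := congrArg (functionFieldMap ι) h1
  simp only [map_mul, map_add, C.map_map, C.map_pull, C.map_w, map_ofNat] at h1 h2 ⊢
  linear_combination h1 - h2

lemma exists_det_eq {y : Y} {d l : (RatFun Y)ˣ} (hd : IsLocalEquation D y d)
    (hl : IsLocalEquation L y l) {g h : RatFun X}
    (hg : SectionOver φ E g y) (hh : SectionOver φ E h y) :
    ∃ c, RegularAt c y ∧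
      (g * functionFieldMap ι h - functionFieldMap ι g * h) * functionFieldMap φ d =
        functionFieldMap φ (c * (l : RatFun Y)) * w := by
  obtain ⟨p, q, -, hq, -, h2⟩ := C.exists_coeffs_mul_map hD hd hl hg hh
  exact ⟨2 * q, (C.unitAt_two y).2.1.mul hq, h2⟩

/-- Not all of the determinants of two sections of `φ_* 𝒪_X(E)` at `y` vanish. -/
lemma exists_unitAt_det [IsFinite φ] [Surjective φ] {y : Y} {d l : (RatFun Y)ˣ}
    (hd : IsLocalEquation D y d) (hl : IsLocalEquation L y l) :
    ∃ g h c, SectionOver φ E g y ∧ SectionOver φ E h y ∧ UnitAt c y ∧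
      (g * functionFieldMap ι h - functionFieldMap ι g * h) * functionFieldMap φ d =
        functionFieldMap φ (c * (l : RatFun Y)) * w := by
  obtain ⟨x, rfl⟩ := φ.surjective y
  obtain ⟨W, hW⟩ := C.exists_sq
  have hz := C.regular_l_mul_w hl
  set z := functionFieldMap φ l * w with hzdef
  obtain ⟨u, hu⟩ := exists_isLocalEquation E x
  obtain ⟨v, hv⟩ := exists_isLocalEquation E (ι x)
  obtain ⟨g, hg, hgu⟩ := exists_sectionOver_unitAt φ E hu
  obtain ⟨h, hh, hhv⟩ := exists_sectionOver_unitAt φ E hv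
  rw [apply_of_comp_eq C.comp] at hh
  obtain ⟨p, q, hp, hq, hk, hdet⟩ := C.exists_coeffs_mul_map hD hd hl hg hh
  -- Here `g` generates $\mathcal O_X(E)$ at $x$ and `h` at $\iota x$, so $p+qz$ is a unit at $x$
  -- and $p$ or $q$ is a unit. If $q$ is not, replacing `g` by $zg$ turns the determinant $2qz$ into
  -- $2pz$.
  have hunit : UnitAt (g * functionFieldMap ι h * functionFieldMap φ d) x := by
    have h3 := (hgu.mul (hhv.map ι)).mul (unitAt_norm hD hd hu hv)
    have hv0 := (map_ne_zero (functionFieldMap ι)).mpr v.ne_zero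
    have hu0 := u.ne_zero
    rw [map_mul] at h3
    convert h3 using 1
    field_simp
  by_cases hqu : UnitAt q (φ x)
  · exact ⟨g, h, 2 * q, hg, hh, (C.unitAt_two _).mul hqu, hdet⟩
  have hpu : UnitAt p (φ x) := by
    by_contra hpu
    refine (VanishAt.add (VanishAt.map φ ⟨hp, hpu⟩)
      (VanishAt.mul_right (VanishAt.map φ ⟨hq, hqu⟩) (hz x rfl))).2 ?_
    rwa [hzdef, ← mul_assoc, ← map_mul, ← hk]
  refine ⟨z * g, h, 2 * p, fun x' hx' => ?_, hh, (C.unitAt_two _).mul hpu, ?_⟩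
  · obtain ⟨u', hu'⟩ := exists_isLocalEquation E x'
    rw [hu'.sectionAt_iff, mul_assoc]
    exact (hz x' hx').mul ((hu'.sectionAt_iff g).mp (hg x' hx'))
  · have hk2 := congrArg (functionFieldMap ι) hk
    simp only [hzdef, map_mul, map_add, C.map_map, C.map_pull, C.map_w, map_ofNat] at hk hk2 ⊢
    linear_combination functionFieldMap φ (l : RatFun Y) * w * (hk + hk2)

/-- The determinant of a splitting of `φ_* 𝒪_X(E)`. -/
theorem exists_det_of_isFrame [IsFinite φ] [Surjective φ] {D₁ D₂ : Divisor Y} {e₁ e₂ : RatFun X}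
    (he : IsFrame φ E D₁ D₂ e₁ e₂) :
    ∃ β : (RatFun Y)ˣ, e₁ * functionFieldMap ι e₂ - functionFieldMap ι e₁ * e₂ =
      functionFieldMap φ β * w ∧ D₁ + D₂ = D - L + principal β := by
  obtain ⟨β, hβ⟩ := C.exists_eq_mul_w
    (g := e₁ * functionFieldMap ι e₂ - functionFieldMap ι e₁ * e₂)
    (by simp only [map_mul, map_sub, C.map_map]; ring)
  have key : ∀ (y : Y) (d l d₁ d₂ : (RatFun Y)ˣ), IsLocalEquation D y d → IsLocalEquation L y l →
      IsLocalEquation D₁ y d₁ → IsLocalEquation D₂ y d₂ →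
      UnitAt (β * (d : RatFun Y) / ((l : RatFun Y) * (d₁ : RatFun Y) * (d₂ : RatFun Y))) y := by
    intro y d l d₁ d₂ hd hl hd₁ hd₂
    have hd0 := d.ne_zero
    have hl0 := l.ne_zero
    have h10 := d₁.ne_zero
    have h20 := d₂.ne_zero
    have hl0' := (map_ne_zero (functionFieldMap φ)).mpr l.ne_zero
    have h10' := (map_ne_zero (functionFieldMap φ)).mpr d₁.ne_zero
    have h20' := (map_ne_zero (functionFieldMap φ)).mpr d₂.ne_zero
    have hE₁ : SectionOver φ E (functionFieldMap φ (d₁ : RatFun Y)⁻¹ * e₁) y :=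
      (he.sectionOver_iff y _).mpr ⟨(d₁ : RatFun Y)⁻¹, 0, (hd₁.sectionAt_iff _).mpr
        (by rw [inv_mul_cancel₀ h10]; exact regularAt_one y), .zero _ _, by simp⟩
    have hE₂ : SectionOver φ E (functionFieldMap φ (d₂ : RatFun Y)⁻¹ * e₂) y :=
      (he.sectionOver_iff y _).mpr ⟨0, (d₂ : RatFun Y)⁻¹, .zero _ _, (hd₂.sectionAt_iff _).mpr
        (by rw [inv_mul_cancel₀ h20]; exact regularAt_one y), by simp⟩
    -- The coefficient `c` belongs to the local basis $d_1^{-1}e_1$, $d_2^{-1}e_2$. Every other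
    -- determinant is `c` times that of a regular coordinate matrix, and one of them is a unit, so
    -- `c` is a unit.
    obtain ⟨c, hc, hcE⟩ := C.exists_det_eq hD hd hl hE₁ hE₂
    have hcβ : c = β * (d : RatFun Y) / ((l : RatFun Y) * (d₁ : RatFun Y) * (d₂ : RatFun Y)) := by
      apply (functionFieldMap φ).injective
      simp only [map_mul, map_inv₀, map_div₀, C.map_pull] at hcE ⊢
      field_simp
      field_simp at hcE
      apply mul_right_cancel₀ C.w_ne_zero
      linear_combination functionFieldMap φ (d : RatFun Y) * hβ - hcE
    rw [← hcβ]
    obtain ⟨g, h, c', hg, hh, hc', hdet⟩ := C.exists_unitAt_det hD hd hl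
    obtain ⟨p, q, hp, hq, rfl⟩ := (he.sectionOver_iff y g).mp hg
    obtain ⟨p', q', hp', hq', rfl⟩ := (he.sectionOver_iff y h).mp hh
    have hp := (hd₁.sectionAt_iff _).mp hp
    have hp' := (hd₁.sectionAt_iff _).mp hp'
    have hq := (hd₂.sectionAt_iff _).mp hq
    have hq' := (hd₂.sectionAt_iff _).mp hq'
    refine UnitAt.of_mul_left hc ((hp.mul hq').sub (hq.mul hp')) ?_
    convert hc' using 1
    apply (functionFieldMap φ).injective
    simp only [hcβ, map_mul, map_div₀, map_add, map_sub, C.map_pull] at hdet ⊢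
    apply mul_right_cancel₀ C.w_ne_zero
    apply mul_right_cancel₀ hl0'
    field_simp
    linear_combination hdet - functionFieldMap φ (d : RatFun Y) *
      (functionFieldMap φ p * functionFieldMap φ q' -
        functionFieldMap φ q * functionFieldMap φ p') * hβ
  have hβ0 : β ≠ 0 := by
    rintro rfl
    obtain ⟨d, hd⟩ := exists_isLocalEquation D (genericPoint Y)
    obtain ⟨l, hl⟩ := exists_isLocalEquation L (genericPoint Y)
    obtain ⟨d₁, hd₁⟩ := exists_isLocalEquation D₁ (genericPoint Y)
    obtain ⟨d₂, hd₂⟩ := exists_isLocalEquation D₂ (genericPoint Y)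
    exact (key _ d l d₁ d₂ hd hl hd₁ hd₂).1 (by simp)
  refine ⟨Units.mk0 β hβ0, hβ, Divisor.ext_of_isLocalEquation fun y => ?_⟩
  obtain ⟨d, hd⟩ := exists_isLocalEquation D y
  obtain ⟨l, hl⟩ := exists_isLocalEquation L y
  obtain ⟨d₁, hd₁⟩ := exists_isLocalEquation D₁ y
  obtain ⟨d₂, hd₂⟩ := exists_isLocalEquation D₂ y
  refine ⟨_, (hd₁.add hd₂).iff_unitAt.mpr ?_, (hd.sub hl).add (isLocalEquation_principal _ y)⟩
  convert key y d l d₁ d₂ hd hl hd₁ hd₂ using 1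
  rw [Units.val_mul, Units.val_mul, Units.val_mul, Units.val_inv_eq_inv_val, Units.val_mk0]
  have hl0 := l.ne_zero
  have h10 := d₁.ne_zero
  have h20 := d₂.ne_zero
  field_simp

end

end CoverData

section Sections

variable {X : Scheme.{u}} [IsIntegral X]

lemma SectionAt.mul_left {D : Divisor X} {r g : RatFun X} {x : X} (hr : RegularAt r x)
    (hg : SectionAt D g x) : SectionAt D (r * g) x := by
  obtain ⟨t, rfl⟩ := hr
  exact hg.smul t

lemma IsEffective.sectionAt {D : Divisor X} (hD : IsEffective D) {g : RatFun X} {x : X}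
    (hg : RegularAt g x) : SectionAt D g x :=
  fun u hu => hg.mul (hD x u hu)

lemma isClosed_support (D : Divisor X) : IsClosed (support D) := by
  rw [← isOpen_compl_iff, isOpen_iff_forall_mem_open]
  intro x hx
  obtain ⟨u, hu⟩ := exists_isLocalEquation D x
  obtain ⟨U, hU, hU'⟩ := hu.eventually
  obtain ⟨V, hV, hV'⟩ := (not_not.mp fun h => hx (hu.mem_support_iff.mpr h)).eventually
  exact ⟨(U ⊓ V : X.Opens), fun y hy h => (hU' y hy.1).mem_support_iff.mp h (hV' y hy.2),
    (U ⊓ V).isOpen, ⟨hU, hV⟩⟩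

end Sections

/-! ### Replacing a basis vector by the function $1$. -/

section Frames

variable {X Y : Scheme.{u}} [IsIntegral X] [IsIntegral Y] {φ : X ⟶ Y} [IsDominant φ]
  {E : Divisor X} {D₁ D₂ : Divisor Y} {e₁ e₂ : RatFun X}

lemma IsFrame.symm (h : IsFrame φ E D₁ D₂ e₁ e₂) : IsFrame φ E D₂ D₁ e₂ e₁ where
  indep p q hpq := (h.indep q p (by rwa [add_comm])).symm
  sectionOver_iff y g := by
    rw [h.sectionOver_iff]
    constructor <;> rintro ⟨p, q, hp, hq, rfl⟩ <;> exact ⟨q, p, hq, hp, add_comm _ _⟩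

lemma IsFrame.ext (h : IsFrame φ E D₁ D₂ e₁ e₂) {p q p' q' : RatFun Y}
    (H : functionFieldMap φ p * e₁ + functionFieldMap φ q * e₂ =
      functionFieldMap φ p' * e₁ + functionFieldMap φ q' * e₂) : p = p' ∧ q = q' := by
  have := h.indep (p - p') (q - q') (by rw [map_sub, map_sub]; linear_combination H)
  exact ⟨sub_eq_zero.mp this.1, sub_eq_zero.mp this.2⟩

lemma IsFrame.exists_one_eq (h : IsFrame φ E D₁ D₂ e₁ e₂) (hE : IsEffective E) :
    ∃ p ∈ H0 D₁, ∃ q ∈ H0 D₂, functionFieldMap φ p * e₁ + functionFieldMap φ q * e₂ = 1 := by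
  have key : ∀ y, ∃ p q, SectionAt D₁ p y ∧ SectionAt D₂ q y ∧
      1 = functionFieldMap φ p * e₁ + functionFieldMap φ q * e₂ := fun y =>
    (h.sectionOver_iff y 1).mp fun x _ => hE.sectionAt (regularAt_one x)
  obtain ⟨p, q, -, -, h1⟩ := key (genericPoint Y)
  -- The coordinates of $1$ are unique, so the local decompositions are all the same one.
  have hpq : ∀ y, SectionAt D₁ p y ∧ SectionAt D₂ q y := fun y => by
    obtain ⟨p', q', hp', hq', h1'⟩ := key y
    obtain ⟨rfl, rfl⟩ := h.ext (h1.symm.trans h1')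
    exact ⟨hp', hq'⟩
  exact ⟨p, fun y => (hpq y).1, q, fun y => (hpq y).2, h1.symm⟩

/-- A frame whose second vector can be exchanged for the function `1`. -/
lemma IsFrame.exchange_one (h : IsFrame φ E D₁ 0 e₁ e₂) {p q : RatFun Y} (hp : p ∈ H0 D₁)
    (hq : ∀ y, UnitAt q y) (h1 : functionFieldMap φ p * e₁ + functionFieldMap φ q * e₂ = 1) :
    IsFrame φ E D₁ 0 e₁ 1 where
  indep r s hrs := by
    have := h.indep (r + s * p) (s * q) (by
      rw [map_add, map_mul, map_mul]
      linear_combination hrs + functionFieldMap φ s * h1)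
    have hs := (mul_eq_zero.mp this.2).resolve_right (hq (genericPoint Y)).1
    rw [hs, zero_mul, add_zero] at this
    exact ⟨this.1, hs⟩
  sectionOver_iff y g := by
    rw [h.sectionOver_iff]
    constructor
    · rintro ⟨r, s, hr, hs, rfl⟩
      rw [sectionAt_zero_iff] at hs
      have hsq := hs.mul (hq y).2.2
      refine ⟨r - s * q⁻¹ * p, s * q⁻¹, ?_, (sectionAt_zero_iff _ _).mpr hsq, ?_⟩
      · rw [sub_eq_add_neg]
        exact hr.add (SectionAt.mul_left hsq (hp y)).neg
      · have hq0 := (map_ne_zero (functionFieldMap φ)).mpr (hq y).1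
        rw [← h1]
        simp only [map_sub, map_mul, map_inv₀]
        field_simp
        ring
    · rintro ⟨r, s, hr, hs, rfl⟩
      rw [sectionAt_zero_iff] at hs
      refine ⟨r + s * p, s * q, hr.add (SectionAt.mul_left hs (hp y)),
        (sectionAt_zero_iff _ _).mpr (hs.mul (hq y).2.1), ?_⟩
      simp only [map_add, map_mul]
      linear_combination (-functionFieldMap φ s) * h1

end Frames

/-! ### Frames containing $1$ and decompositions of $W$. -/

namespace CoverData

variable {X Y : Scheme.{u}} [IsIntegral X] [IsIntegral Y]
  {φ : X ⟶ Y} {ι : X ⟶ X} [IsDominant φ] [IsDominant ι] {L : Divisor Y} {w : RatFun X}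
  (C : CoverData φ ι L w) {W : (RatFun Y)ˣ} (hW : functionFieldMap φ W = w * w)
  {E : Divisor X} {D : Divisor Y} (hD : pullbackDivisor φ D = E + pullbackDivisor ι E)

section
include C hW hD

/-- With $e=\alpha+\beta'w$, the function sought is $a=\alpha/\beta'$. The conditions on it are the
regularity of the coordinates of $z$ times a local generator of the first summand. -/
theorem exists_sub_sq_mem_of_isFrame [IsFinite φ] [Surjective φ] {D₁ : Divisor Y} {e : RatFun X}
    (he : IsFrame φ E D₁ 0 e 1) : ∃ a ∈ H0 L, (W : RatFun Y) - a ^ 2 ∈ H0 ((2 : ℕ) • L - D) := by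
  obtain ⟨β, hβ, hdiv⟩ := C.exists_det_of_isFrame hD he
  rw [add_zero] at hdiv
  obtain ⟨α, β', rfl⟩ := C.exists_eq_add e
  have hβ' : (β : RatFun Y) = 2 * β' := by
    apply (functionFieldMap φ).injective
    apply mul_right_cancel₀ C.w_ne_zero
    simp only [map_one, map_add, map_mul, C.map_pull, C.map_w, map_ofNat] at hβ ⊢
    linear_combination -hβ
  have hβ0 : β' ≠ 0 := by
    rintro rfl
    exact β.ne_zero (by rw [hβ', mul_zero])
  have key : ∀ y, SectionAt L (α / β') y ∧
      SectionAt ((2 : ℕ) • L - D) ((W : RatFun Y) - (α / β') ^ 2) y := by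
    intro y
    obtain ⟨d, hd⟩ := exists_isLocalEquation D y
    obtain ⟨l, hl⟩ := exists_isLocalEquation L y
    have hd0 := d.ne_zero
    have hl0 := l.ne_zero
    have h2 := C.two_ne_zero
    have hD₁ : IsLocalEquation D₁ y (d * l⁻¹ * β) := by
      rw [hdiv]
      exact (hd.sub hl).add (isLocalEquation_principal _ y)
    have hsec : ∀ p, SectionAt D₁ p y ↔ RegularAt (p * ((d : RatFun Y) * (l : RatFun Y)⁻¹ * β')) y := by
      intro p
      rw [hD₁.sectionAt_iff, ← RegularAt.mul_unitAt_iff (C.unitAt_two y)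
        (g := p * ((d : RatFun Y) * (l : RatFun Y)⁻¹ * β'))]
      simp only [Units.val_mul, Units.val_inv_eq_inv_val, hβ']
      rw [show p * ((d : RatFun Y) * (l : RatFun Y)⁻¹ * β') * 2 =
        p * ((d : RatFun Y) * (l : RatFun Y)⁻¹ * (2 * β')) by ring]
    -- Chosen so that $te=(l/d)(w+a)$ generates the first summand at `y`.
    set t : RatFun Y := (l : RatFun Y) / ((d : RatFun Y) * β') with ht
    have hM : SectionOver φ E
        (functionFieldMap φ t * (functionFieldMap φ α + functionFieldMap φ β' * w)) y :=
      (he.sectionOver_iff y _).mpr ⟨t, 0, (hsec t).mpr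
        (by convert regularAt_one y using 1; rw [ht]; field_simp), .zero _ _, by simp⟩
    -- The module is stable under $z=lw$. Relative to the generator $te$ and $1$, the product
    -- $z\cdot te$ has coordinates $la$ and $(l^2/d)(W-a^2)$.
    obtain ⟨p, q, hp, hq, hpq⟩ := (he.sectionOver_iff y _).mp fun x hx =>
      SectionAt.mul_left (C.regular_l_mul_w hl x hx) (hM x hx)
    rw [hsec] at hp
    rw [sectionAt_zero_iff] at hq
    obtain ⟨h₁, h₂⟩ := C.eq_and_eq (p := (l : RatFun Y) * t * β' * W)
      (q := (l : RatFun Y) * t * α) (p' := p * α + q) (q' := p * β') (by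
        simp only [map_add, map_mul, hW]
        linear_combination hpq)
    have hp' : p = (l : RatFun Y) * t * α / β' := by rw [h₂]; field_simp
    have hq' : q = (l : RatFun Y) * t * β' * W - p * α := by rw [h₁]; ring
    refine ⟨(hl.sectionAt_iff _).mpr ?_, (hl.two_nsmul.sub hd).sectionAt_iff _ |>.mpr ?_⟩
    · convert hp using 1
      rw [hp', ht]
      field_simp
    · convert hq using 1
      rw [hq', hp', ht]
      simp only [Units.val_mul, Units.val_inv_eq_inv_val]
      field_simp
  exact ⟨_, fun y => (key y).1, fun y => (key y).2⟩

end

section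
include C hW

/-- If the branch divisor is `a² + (equation of D)`, then one of the two functions `w ∓ a` vanishes
on an irreducible component of the pullback of `D`. -/
lemma exists_regularAt_div (hE : IsIrreducibleDivisor E)
    (hD : pullbackDivisor φ D = E + pullbackDivisor ι E) {a : RatFun Y} (ha : a ∈ H0 L)
    (ha' : (W : RatFun Y) - a ^ 2 ∈ H0 ((2 : ℕ) • L - D)) :
    ∃ a' ∈ H0 L, ∀ (x : X) (l : (RatFun Y)ˣ) (u : (RatFun X)ˣ), IsLocalEquation L (φ x) l →
      IsLocalEquation E x u →
      RegularAt (functionFieldMap φ l * (w - functionFieldMap φ a') / (u : RatFun X)) x := by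
  have hreg : ∀ b ∈ H0 L, ∀ (x : X) (l : (RatFun Y)ˣ), IsLocalEquation L (φ x) l →
      RegularAt (functionFieldMap φ l * (w - functionFieldMap φ b)) x := by
    intro b hb x l hl
    have := (C.regular_l_mul_w hl x rfl).sub (((hl.sectionAt_iff b).mp (hb (φ x))).map φ)
    rw [map_mul] at this
    convert this using 1
    ring
  obtain ⟨ξ, hξ⟩ : ∃ ξ, IsGenericPoint ξ (support E) :=
    ⟨_, hE.2.2.isGenericPoint_genericPoint (isClosed_support E)⟩
  have hna : -a ∈ H0 L := neg_mem ha
  have main : ∃ a' ∈ H0 L, ∀ l : (RatFun Y)ˣ, IsLocalEquation L (φ ξ) l →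
      ¬ UnitAt (functionFieldMap φ l * (w - functionFieldMap φ a')) ξ := by
    -- If neither $w-a$ nor $w+a$ vanished at the generic point $\xi$ of $E$, their product $W-a^2$,
    -- up to $l$-factors, would be a unit there. It is divisible by $d$, hence by the equation of
    -- $E$, which would then be a unit on its own support.
    by_contra! H
    obtain ⟨l₁, hl₁, hu₁⟩ := H a ha
    obtain ⟨l₂, hl₂, hu₂⟩ := H (-a) hna
    obtain ⟨d, hd⟩ := exists_isLocalEquation D (φ ξ)
    obtain ⟨u, hu⟩ := exists_isLocalEquation E ξ
    obtain ⟨v, hv⟩ := exists_isLocalEquation E (ι ξ)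
    have h₁ := ((hl₁.two_nsmul.sub hd).sectionAt_iff _).mp (ha' (φ ξ))
    have h₂ := ((hl₁.unitAt_div hl₂).map φ).2.1
    have h₃ := (unitAt_norm hD hd hu hv).2.1
    have h₄ := (hE.1 _ v hv).map ι
    refine (hu.mem_support_iff.mp hξ.mem) (UnitAt.of_mul_left (hE.1 ξ u hu)
      (((h₁.map φ).mul h₂).mul (h₃.mul h₄)) ?_)
    convert hu₁.mul hu₂ using 1
    have hd0 := (map_ne_zero (functionFieldMap φ)).mpr d.ne_zero
    have hl0 := (map_ne_zero (functionFieldMap φ)).mpr l₁.ne_zero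
    have hu0 := u.ne_zero
    have hv0 := (map_ne_zero (functionFieldMap ι)).mpr v.ne_zero
    simp only [Units.val_mul, Units.val_inv_eq_inv_val, map_mul, map_sub, map_pow, map_neg, map_inv₀,
      map_div₀, hW]
    field_simp
    ring
  obtain ⟨a', ha'', hξ'⟩ := main
  refine ⟨a', ha'', fun x l u hl hu => regularAt_div_of_vanishAt hE.2.1 hE.1 hu
    (hreg a' ha'' x l hl) fun y hyx hy hyu => ?_⟩
  have hξy : ξ ⤳ y := hξ.specializes hy
  exact hξ' l (hl.specializes ((hξy.trans hyx).map φ.continuous)) (hyu.specializes hξy)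

end

include C hW hD in
theorem exists_isFrame_of_sub_sq_mem [IsFinite φ] [Surjective φ] (hE : IsIrreducibleDivisor E)
    {a : RatFun Y} (ha : a ∈ H0 L) (ha' : (W : RatFun Y) - a ^ 2 ∈ H0 ((2 : ℕ) • L - D)) :
    ∃ b, IsFrame φ E (D - L) 0 (w + functionFieldMap φ b) 1 := by
  obtain ⟨b, hb, hdvd⟩ := C.exists_regularAt_div hW hE hD ha ha'
  have hM : ∀ (y : Y) (d l : (RatFun Y)ˣ), IsLocalEquation D y d → IsLocalEquation L y l →
      SectionOver φ E (functionFieldMap φ ((l : RatFun Y) / (d : RatFun Y)) *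
        (w + functionFieldMap φ b)) y := by
    rintro y d l hd hl x rfl
    obtain ⟨u, hu⟩ := exists_isLocalEquation E x
    obtain ⟨v, hv⟩ := exists_isLocalEquation E (ι x)
    have hx := apply_of_comp_eq C.comp x
    -- Conjugating divisibility of $l(w-b)$ by the equation of $E$ at $\iota x$ gives divisibility
    -- of $l(w+b)$ by that of $\iota^*E$ at $x$. Dividing by $d$ then leaves poles along $E$ only.
    have h₁ := ((hdvd (ι x) l v (hx.symm ▸ hl) hv).map ι).neg
    have h₂ := h₁.mul (unitAt_norm hD hd hu hv).2.2
    rw [hu.sectionAt_iff]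
    convert h₂ using 1
    have hd0 := (map_ne_zero (functionFieldMap φ)).mpr d.ne_zero
    have hu0 := u.ne_zero
    have hv0 := (map_ne_zero (functionFieldMap ι)).mpr v.ne_zero
    simp only [map_mul, map_sub, map_div₀, C.map_pull, C.map_w]
    field_simp
    ring
  refine ⟨b, fun p q hpq => ?_, fun y g => ?_⟩
  · obtain ⟨h₁, h₂⟩ := C.eq_zero_of_add_eq_zero (p := p * b + q) (q := p) (by
      rw [map_add, map_mul]
      linear_combination hpq)
    rw [h₂, zero_mul, zero_add] at h₁
    exact ⟨h₂, h₁⟩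
  obtain ⟨d, hd⟩ := exists_isLocalEquation D y
  obtain ⟨l, hl⟩ := exists_isLocalEquation L y
  have hd0 := d.ne_zero
  have hl0 := l.ne_zero
  have hone : ∀ r, RegularAt r y → SectionOver φ E (functionFieldMap φ r) y := fun r hr x hx =>
    hE.1.sectionAt (RegularAt.map φ (hx.symm ▸ hr))
  constructor
  · intro hg
    -- Cramer's rule: the determinants of `g` with $1$ and with $M=(l/d)(w+b)$ are its coordinates
    -- up to sign and the factor $2$, since the determinant of $M$ and $1$, multiplied by $d$, is
    -- $2z$.
    obtain ⟨c₁, hc₁, h₁⟩ := C.exists_det_eq hD hd hl hg (hone 1 (regularAt_one y))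
    obtain ⟨c₂, hc₂, h₂⟩ := C.exists_det_eq hD hd hl hg (hM y d l hd hl)
    have h20 := C.two_ne_zero
    have h20' := C.two_ne_zero'
    refine ⟨c₁ / 2 * ((l : RatFun Y) / (d : RatFun Y)), - (c₂ / 2), ?_, ?_, ?_⟩
    · rw [(hd.sub hl).sectionAt_iff]
      convert hc₁.mul (C.unitAt_two y).2.2 using 1
      rw [Units.val_mul, Units.val_inv_eq_inv_val]
      field_simp
    · rw [sectionAt_zero_iff]
      exact (hc₂.mul (C.unitAt_two y).2.2).neg
    · have hd0' := (map_ne_zero (functionFieldMap φ)).mpr hd0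
      have hl0' := (map_ne_zero (functionFieldMap φ)).mpr hl0
      have hw := C.w_ne_zero
      simp only [map_mul, map_add, map_neg, map_div₀, map_one, map_ofNat, C.map_pull, C.map_w]
        at h₁ h₂ ⊢
      have key : functionFieldMap φ (l : RatFun Y) * w * (2 * g * functionFieldMap φ d) =
          functionFieldMap φ (l : RatFun Y) * w * (functionFieldMap φ c₁ *
            functionFieldMap φ l * (w + functionFieldMap φ b) -
              functionFieldMap φ c₂ * functionFieldMap φ d) := by
        have h₂' : functionFieldMap φ (l : RatFun Y) * (g * (-w + functionFieldMap φ b) -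
            functionFieldMap ι g * (w + functionFieldMap φ b)) =
            functionFieldMap φ c₂ * functionFieldMap φ l * w := by
          rw [← h₂]
          field_simp
        linear_combination functionFieldMap φ (l : RatFun Y) * (w + functionFieldMap φ b) * h₁ -
          functionFieldMap φ (d : RatFun Y) * h₂'
      have := mul_left_cancel₀ (mul_ne_zero hl0' hw) key
      field_simp
      linear_combination this
  · rintro ⟨p, q, hp, hq, rfl⟩ x rfl
    rw [(hd.sub hl).sectionAt_iff] at hp
    rw [sectionAt_zero_iff] at hq
    refine SectionAt.add ?_ (by rw [mul_one]; exact hone q hq x rfl)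
    have := SectionAt.mul_left (hp.map φ) (hM (φ x) d l hd hl x rfl)
    convert this using 1
    rw [← mul_assoc, ← map_mul, Units.val_mul, Units.val_inv_eq_inv_val]
    congr 2
    field_simp

end CoverData

end DoubleCover

/-! ### The theorem. -/

theorem mainTheorem2 {X Y : Scheme.{0}} [IsIntegral X] [IsIntegral Y]
    -- `Y` is a smooth variety over `ℂ`
    (sY : Y ⟶ Spec (CommRingCat.of ℂ)) [AlgebraicGeometry.IsSeparated sY] [QuasiCompact sY]
    [Smooth sY]
    -- `φ : X ⟶ Y` is a finite surjective morphism of degree two, with `X` smooth over `ℂ`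
    (φ : X ⟶ Y) [IsFinite φ] [Surjective φ] [Smooth (φ ≫ sY)]
    (hdeg : DoubleCover.degree φ = 2)
    -- `ι` is the covering transformation
    (ι : X ≅ X) (hι : ι.hom ≫ φ = φ) (hι_ne : ι.hom ≠ 𝟙 X)
    -- `φ_* 𝒪_X ≅ 𝒪_Y ⊕ 𝒪_Y(-L)`
    (L : DoubleCover.Divisor Y)
    (hL : Nonempty ((Scheme.Modules.pushforward φ).obj (DoubleCover.structureModule X) ≅
      DoubleCover.structureModule Y ⊞ DoubleCover.lineBundle (-L)))
    -- `B` is the branch locus, and `F` is a section of `𝒪_Y(2L) ≅ 𝒪_Y(B)` defining it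
    (B : DoubleCover.Divisor Y) (hB : DoubleCover.IsBranchDivisor φ B)
    (F : (DoubleCover.RatFun Y)ˣ)
    (hF : (F : DoubleCover.RatFun Y) ∈ DoubleCover.H0 ((2 : ℕ) • L))
    (hFB : DoubleCover.zeroDivisor ((2 : ℕ) • L) F = B)
    -- `H⁰(Y, 𝒪_Y) = ℂ`
    (hY : IsIso sY.appTop)
    -- `D⁺` is an effective divisor on `X`, and `D` is the divisor of zeros of `f`
    (Dplus : DoubleCover.Divisor X) (hDplus : DoubleCover.IsEffective Dplus)
    (D : DoubleCover.Divisor Y) (hD : DoubleCover.IsEffective D)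
    (f : (DoubleCover.RatFun Y)ˣ) (hf : (f : DoubleCover.RatFun Y) ∈ DoubleCover.H0 D)
    (hfD : DoubleCover.zeroDivisor D f = D)
    (hφD : DoubleCover.pullbackDivisor φ D =
      Dplus + DoubleCover.pullbackDivisor ι.hom Dplus) :
    (∀ D' : DoubleCover.Divisor Y,
      Nonempty ((Scheme.Modules.pushforward φ).obj (DoubleCover.lineBundle Dplus) ≅
        DoubleCover.lineBundle D' ⊞ DoubleCover.structureModule Y) →
      (Nonempty (DoubleCover.lineBundle D' ≅ DoubleCover.structureModule Y) ∨
        DoubleCover.H0 D' = ⊥) →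
      DoubleCover.LinEquiv D' (D - L) ∧
        ∃ a₀ ∈ DoubleCover.H0 L, ∃ a₁ ∈ DoubleCover.H0 ((2 : ℕ) • L - D),
          (F : DoubleCover.RatFun Y) = a₀ ^ 2 + (f : DoubleCover.RatFun Y) * a₁) ∧
    (DoubleCover.IsIrreducibleDivisor Dplus →
      (∃ a₀ ∈ DoubleCover.H0 L, ∃ a₁ ∈ DoubleCover.H0 ((2 : ℕ) • L - D),
        (F : DoubleCover.RatFun Y) = a₀ ^ 2 + (f : DoubleCover.RatFun Y) * a₁) →
      Nonempty ((Scheme.Modules.pushforward φ).obj (DoubleCover.lineBundle Dplus) ≅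
        DoubleCover.lineBundle (D - L) ⊞ DoubleCover.structureModule Y)) := by
  have h2 : ∀ y : Y, DoubleCover.UnitAt (2 : DoubleCover.RatFun Y) y :=
    DoubleCover.unitAt_two sY
  obtain ⟨jX⟩ := DoubleCover.structureModule_nonempty_iso_lineBundle_zero (Y := X)
  obtain ⟨jY⟩ := DoubleCover.structureModule_nonempty_iso_lineBundle_zero (Y := Y)
  obtain ⟨w, C⟩ := DoubleCover.exists_coverData hdeg hι hι_ne h2 L
    (hL.map fun i => (Scheme.Modules.pushforward φ).mapIso jX.symm ≪≫ i ≪≫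
      biprod.mapIso jY (Iso.refl _))
  obtain ⟨W, hW⟩ := C.exists_sq
  have hWB := C.zeroDivisor_eq hW (fun x h => DoubleCover.RegularAt.of_sq (φ ≫ sY)) hB
  -- up to a constant square, `F` is the square of `w`
  obtain ⟨t, ht, hFW⟩ : ∃ t : DoubleCover.RatFun Y, (∀ y, DoubleCover.UnitAt t y) ∧
      (F : DoubleCover.RatFun Y) = t ^ 2 * (W : DoubleCover.RatFun Y) := by
    have hFW : DoubleCover.principal F = DoubleCover.principal W :=
      add_left_cancel (hFB.trans hWB.symm)
    have hu : ∀ y, DoubleCover.UnitAt ((F : DoubleCover.RatFun Y) / (W : DoubleCover.RatFun Y)) y := fun y =>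
      DoubleCover.IsLocalEquation.unitAt_div (DoubleCover.isLocalEquation_principal W y)
        (hFW ▸ DoubleCover.isLocalEquation_principal F y)
    -- Equal divisors make $F/W$ a global unit, hence a complex number, which has a square root.
    obtain ⟨c, hc⟩ := DoubleCover.exists_constants_eq sY hY fun y => (hu y).2.1
    obtain ⟨r, rfl⟩ := IsAlgClosed.exists_pow_nat_eq c two_pos
    have hr : r ≠ 0 := by
      rintro rfl
      refine (hu (genericPoint Y)).1 ?_
      rw [← hc]
      simp
    refine ⟨DoubleCover.constants sY r, DoubleCover.unitAt_constants sY hr, ?_⟩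
    rw [← map_pow, hc, div_mul_cancel₀ _ W.ne_zero]
  -- As a rational function, the section of $\mathcal O_Y(D)$ with zero divisor $D$ is $1$ up to a
  -- unit: $D+\operatorname{div}f=D$ forces $\operatorname{div}f=0$.
  have hfu : ∀ y, DoubleCover.UnitAt (f : DoubleCover.RatFun Y) y := fun y => by
    have h : DoubleCover.principal f = 0 := add_eq_left.mp hfD
    have := DoubleCover.IsLocalEquation.unitAt_div (DoubleCover.isLocalEquation_zero y)
      (h ▸ DoubleCover.isLocalEquation_principal f y)
    rwa [Units.val_one, div_one] at this
  have hf0 := f.ne_zero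
  have ht0 := (ht (genericPoint Y)).1
  refine ⟨fun D' ⟨i⟩ hD' => ?_, fun hirr ⟨a₀, ha₀, a₁, ha₁, hF'⟩ => ?_⟩
  · let i' := i ≪≫ biprod.mapIso (Iso.refl _) jY
    obtain ⟨e₁, e₂, he⟩ := DoubleCover.exists_isFrame i'
    refine ⟨?_, ?_⟩
    · obtain ⟨β, -, h⟩ := C.exists_det_of_isFrame hφD he
      exact ⟨β, by rwa [add_zero] at h⟩
    -- the splitting can be chosen so that the second vector is `1`
    obtain ⟨D₁, e, he'⟩ : ∃ D₁ e, DoubleCover.IsFrame φ Dplus D₁ 0 e 1 := by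
      have hconst : ∀ q ∈ DoubleCover.H0 (0 : DoubleCover.Divisor Y), q ≠ 0 →
          ∀ y, DoubleCover.UnitAt q y := by
        intro q hq hq0
        obtain ⟨c, rfl⟩ := DoubleCover.exists_constants_eq sY hY fun y =>
          (DoubleCover.sectionAt_zero_iff q y).mp (hq y)
        exact DoubleCover.unitAt_constants sY fun h => hq0 (by rw [h, map_zero])
      -- Write $1=pe_1+qe_2$. If $\mathcal O_Y(D')$ is trivial, both coefficients are constants and
      -- a nonzero one marks the vector to exchange. If $H^0(D')=0$, then $p=0$ and $q$ is a nonzero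
      -- constant.
      rcases hD' with ⟨⟨k⟩⟩ | hD'
      · obtain ⟨e₁, e₂, he⟩ := DoubleCover.exists_isFrame
          (i ≪≫ biprod.mapIso (k ≪≫ jY) jY)
        obtain ⟨p, hp, q, hq, h1⟩ := he.exists_one_eq hDplus
        by_cases hq0 : q = 0
        · have hp0 : p ≠ 0 := by
            rintro rfl
            simp [hq0] at h1
          exact ⟨_, _, he.symm.exchange_one hq (hconst p hp hp0) (by rwa [add_comm])⟩
        · exact ⟨_, _, he.exchange_one hp (hconst q hq hq0) h1⟩
      · obtain ⟨p, hp, q, hq, h1⟩ := he.exists_one_eq hDplus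
        have hp0 : p = 0 := by
          rw [hD'] at hp
          exact hp
        refine ⟨_, _, he.exchange_one hp (hconst q hq ?_) h1⟩
        rintro rfl
        simp [hp0] at h1
    obtain ⟨a, ha, ha'⟩ := C.exists_sub_sq_mem_of_isFrame hW hφD he'
    refine ⟨t * a, fun y => .mul_left (ht y).2.1 (ha y),
      t ^ 2 / (f : DoubleCover.RatFun Y) * ((W : DoubleCover.RatFun Y) - a ^ 2), fun y => .mul_left (((ht y).pow 2).div (hfu y)).2.1 (ha' y), ?_⟩
    rw [hFW]
    field_simp
    ring
  · have haW : (W : DoubleCover.RatFun Y) - (t⁻¹ * a₀) ^ 2 = (f : DoubleCover.RatFun Y) / t ^ 2 * a₁ := by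
      rw [hFW] at hF'
      field_simp
      linear_combination hF'
    obtain ⟨b, hb⟩ := C.exists_isFrame_of_sub_sq_mem hW hφD hirr (a := t⁻¹ * a₀)
      (fun y => .mul_left (ht y).2.2 (ha₀ y)) (by
        rw [haW]
        exact fun y => .mul_left ((hfu y).div ((ht y).pow 2)).2.1 (ha₁ y))
    obtain ⟨j⟩ := hb.nonempty_iso fun g => by
      obtain ⟨p, q, rfl⟩ := C.exists_eq_add g
      -- From $p+qw=q(w+b)+(p-qb)$.
      exact ⟨q, p - q * b, by rw [map_sub, map_mul]; ring⟩
    exact ⟨j ≪≫ biprod.mapIso (Iso.refl _) jY.symm⟩
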